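/- Conventions. A BIDMC has input alphabet $\{0,1\}$ (uniformly distributed input) and a discrete output alphabet $\mathcal Y$. Its error probability is $P_\epsilon(W)=\frac12\sum_{y}\min\{\Pr(y|0),\Pr(y|1)\}$. Its LR-profile $P_W$ assigns to $\varepsilon\in[0,1]$ the probability that the output $y$ has likelihood ratio $\Pr(y|0)/\Pr(y|1)=\varepsilon/(1-\varepsilon)$; $W\cong W'$ means $P_W=P_{W'}$. $W'\preccurlyeq W$ ($W'$ is a degradation of $W$) means that $W'$ is $W$ followed by some channel from the outputs of $W$ to the outputs of $W'$. $\mathrm B(\varepsilon)$ is the binary symmetric channel with crossover probability $\varepsilon$, and $\sum_j p_jW_j$ (with $p_j\ge 0$, $\sum_j p_j=1$) is the channel that uses $W_j$ with probability $p_j$, the index $j$ being revealed to the receiver. $\mathbb B_n$ is the set of BIDMCs equivalent to some $\sum_{j=1}^n p_j\mathrm B(\varepsilon_j)$, and $\mathbb B_n^*=\mathbb B_n\setminus\mathbb B_{n-1}$. For $W\in\mathbb B_n$ and $Q\in\mathbb B_m$, $W\preccurlyeq_{\mathrm P}Q$ means $W\preccurlyeq Q$ and $P_\epsilon(W)=\min\{P_\epsilon(W'):W'\in\mathbb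 B_n,\ W'\preccurlyeq Q\}$. Let $Q=\sum_{i=1}^m q_i\mathrm B(\sigma_i)\in\mathbb B_m^*$ with $0\le\sigma_1<\cdots<\sigma_m\le 1/2$, and put $q_0=q_{m+1}=0$. For $1\le i_2<\cdots<i_n\le m$ and $0\le s_j\le q_{i_j}$ ($2\le j\le n$), with $i_1=s_1=0$, $i_{n+1}=m+1$, $s_{n+1}=0$, the notation $D_Q(i_2,\dots,i_n;s_2,\dots,s_n)$ stands for the channel $\sum_{j=1}^n p_j\mathrm B(\varepsilon_j)\in\mathbb B_n^*$ with $$p_j=s_j+\sum_{i_j<i<i_{j+1}}q_i+(q_{i_{j+1}}-s_{j+1}),\qquad p_j\varepsilon_j=s_j\sigma_{i_j}+\sum_{i_j<i<i_{j+1}}q_i\sigma_i+(q_{i_{j+1}}-s_{j+1})\sigma_{i_{j+1}}$$ for $1\le j\le n$ (terms with coefficient zero being omitted). Theorem. Let $m>n\ge 2$, let $Q$ be as above, and let $W\in\mathbb B_n$ with $W\preccurlyeq Q$. Then there exist $1\le i_2<\cdots<i_n\le m$ and $0\le s_j\le q_{i_j}$ ($j=2,\dots,n$) such that $D=D_Q(i_2,\dots,i_n;s_2,\dots,s_n)=\sum_{j=1}^n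 p_j\mathrm B(\varepsilon_j)$ is in $\mathbb B_n^*$, $0\le\varepsilon_1<\cdots<\varepsilon_n\le 1/2$, and $$W\preccurlyeq D\preccurlyeq_{\mathrm P}Q,$$ where moreover $W\preccurlyeq_{\mathrm P}D$ if $W\preccurlyeq_{\mathrm P}Q$. Furthermore, for each $j\in\{1,\dots,n\}$ with $i_{j+1}=i_j+1$: 1. if $s_j=0$, then $s_{j+1}=0$, $p_j=q_{i_{j+1}}$ and $\varepsilon_j=\sigma_{i_{j+1}}$; 2. if $s_{j+1}=q_{i_{j+1}}$, then $s_j=q_{i_j}$, $p_j=q_{i_j}$ and $\varepsilon_j=\sigma_{i_j}$. (Here 1 says for $j=n$ that $s_n=0$ is impossible when $i_n=m$, and 2 says for $j=1$ that $s_2=q_1$ is impossible when $i_2=1$.) Moreover $p_j\ge q_i$ whenever $\varepsilon_j=\sigma_i$; and $p_1\ge q_1$ and $p_n\ge q_m$. -/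

import Mathlib

open scoped ENNReal

noncomputable section

/-- A binary-input discrete memoryless channel: for each input bit `x` a probability mass function
`law x` on the output alphabet, `law x y = Pr(y | x)`. -/
structure BIDMC where
  /-- the output alphabet -/
  Out : Type
  /-- the transition probabilities -/
  law : ZMod 2 → PMF Out

namespace BIDMC

/-- Decoding error probability of maximum likelihood decoding under the uniform input. -/
def errorProb (W : BIDMC) : ℝ≥0∞ :=
  2⁻¹ * ∑' y, min (W.law 0 y) (W.law 1 y)

/-- The outputs whose likelihood ratio `Pr(y | 0) / Pr(y | 1)` equals `ε / (1 - ε)`; the ratio is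
taken in `[0, ∞]`, so that `ε = 1` corresponds to `∞`. (Outputs of probability zero have ratio
`0 / 0 = 0` and do not contribute to any probability.) -/
def lrSet (W : BIDMC) (ε : unitInterval) : Set W.Out :=
  {y | W.law 0 y / W.law 1 y = ENNReal.ofReal (ε : ℝ) / ENNReal.ofReal (1 - (ε : ℝ))}

/-- The likelihood-ratio profile: `P_W(ε)` is the probability, under the uniform input, that the
output lies in `lrSet W ε`. -/
def lrProfile (W : BIDMC) (ε : unitInterval) : ℝ≥0∞ :=
  ∑' y : W.lrSet ε, 2⁻¹ * (W.law 0 y + W.law 1 y)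

/-- Equivalence of channels: equality of the likelihood-ratio profiles. -/
def Equivalent (W W' : BIDMC) : Prop :=
  ∀ ε : unitInterval, W.lrProfile ε = W'.lrProfile ε

/-- `W'.IsDegradation W`: `W'` is obtained from `W` by an intermediate channel `K`, i.e.
`Pr(y' | x) = ∑ y, Pr(y | x) K(y' | y)`. -/
def IsDegradation (W' W : BIDMC) : Prop :=
  ∃ K : W.Out → PMF W'.Out, ∀ x : ZMod 2, W'.law x = (W.law x).bind K

/-- The binary symmetric channel `B(ε)` with crossover probability `ε`. -/
def bsc (ε : unitInterval) : BIDMC where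
  Out := ZMod 2
  law x := PMF.ofFintype
    (fun y => if y = x then ENNReal.ofReal (1 - (ε : ℝ)) else ENNReal.ofReal (ε : ℝ)) (by
      have h : ENNReal.ofReal (1 - (ε : ℝ)) + ENNReal.ofReal (ε : ℝ) = 1 := by
        rw [← ENNReal.ofReal_add (sub_nonneg.2 ε.2.2) ε.2.1]
        simp
      have h' : ENNReal.ofReal (ε : ℝ) + ENNReal.ofReal (1 - (ε : ℝ)) = 1 := by
        rw [add_comm]
        exact h
      change ∑ y : Fin 2, _ = _
      rw [Fin.sum_univ_two]
      fin_cases x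
      · exact h
      · exact h')

/-- A probability vector as a probability mass function. -/
def weightPMF {n : ℕ} (p : stdSimplex ℝ (Fin n)) : PMF (Fin n) :=
  PMF.ofFintype (fun j => ENNReal.ofReal (p j)) (by
    have h := ENNReal.ofReal_sum_of_nonneg (s := Finset.univ) (fun j _ => p.2.1 j)
    exact h.symm.trans ((congrArg ENNReal.ofReal p.2.2).trans ENNReal.ofReal_one))

/-- The random switching channel `∑ j, p j • W j`: the input is sent over `W j` with
probability `p j`, and the receiver sees which sub-channel was used. -/
def rsc {n : ℕ} (p : stdSimplex ℝ (Fin n)) (W : Fin n → BIDMC) : BIDMC where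
  Out := Σ j, (W j).Out
  law x := (weightPMF p).bind fun j => ((W j).law x).map (Sigma.mk j)

/-- The random switching channel `∑ j, p j • B(ε j)` of binary symmetric channels. -/
def bscMix {n : ℕ} (p : stdSimplex ℝ (Fin n)) (ε : Fin n → unitInterval) : BIDMC :=
  rsc p fun j => bsc (ε j)

/-- The set `𝔹_n` of the channels that are equivalent to a random switching channel of `n` binary
symmetric channels (such channels are automatically symmetric). -/
def SymSet (n : ℕ) : Set BIDMC :=
  {W | ∃ (p : stdSimplex ℝ (Fin n)) (ε : Fin n → unitInterval), W.Equivalent (bscMix p ε)}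

/-- The set `𝔹*_n = 𝔹_n \ 𝔹_{n-1}` (used for `n > 1`). -/
def SymSetStar (n : ℕ) : Set BIDMC :=
  SymSet n \ SymSet (n - 1)

/-- `W` is a `(2m, 2n)`-P-degradation of `Q`: `Q ∈ 𝔹_m`, and `W` is a degradation of `Q` in `𝔹_n`
whose decoding error probability is the least among all degradations of `Q` in `𝔹_n`. -/
def IsPDegradation (m n : ℕ) (W Q : BIDMC) : Prop :=
  Q ∈ SymSet m ∧ W ∈ SymSet n ∧ W.IsDegradation Q ∧
    IsLeast (errorProb '' {W' | W' ∈ SymSet n ∧ W'.IsDegradation Q}) W.errorProb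

/-- Extension of a family with labels `1, …, m` (the entry labelled `l` is `f ⟨l - 1, _⟩`) to all
labels, by zero. -/
def labelled {m : ℕ} (f : Fin m → ℝ) (l : ℕ) : ℝ :=
  if h : 1 ≤ l ∧ l ≤ m then f ⟨l - 1, by omega⟩ else 0

/-- The weights `r_l` of the `(a, b; t, t')`-segment `∑_{a ≤ l ≤ b} r_l B(σ_l)` of a channel
`∑_{1 ≤ l ≤ m} q_l B(σ_l)`, where `a < b`: `r_a = t`, `r_b = q_b - t'`, and `r_l = q_l` for
`a < l < b`. -/
def segment {m : ℕ} (q : Fin m → ℝ) (a b : ℕ) (t t' : ℝ) (l : ℕ) : ℝ :=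
  if l = a then t
  else if l = b then labelled q b - t'
  else if a < l ∧ l < b then labelled q l
  else 0

/-- The particle `p B(ε)` is compounded from the particles `k_l B(σ_l)`, `l ∈ S`. -/
def IsCompounded (p ε : ℝ) (S : Finset ℕ) (k σ : ℕ → ℝ) : Prop :=
  p = ∑ l ∈ S, k l ∧ (∀ l ∈ S, σ l ∈ Set.Icc (0 : ℝ) (1 / 2)) ∧ p * ε = ∑ l ∈ S, k l * σ l

/-- Splitting patterns `(i_2, s_2), …, (i_n, s_n)` with `1 ≤ i_2 < ⋯ < i_n ≤ m` and
`0 ≤ s_j ≤ q_{i_j}`, together with the boundary conventions `i_1 = s_1 = 0`, `i_{n+1} = m + 1`,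
`s_{n+1} = 0`. The entry with index `j : Fin (n + 1)` is the pair `(i_{j+1}, s_{j+1})`. -/
structure SplittingPatterns {m : ℕ} (q : Fin m → ℝ) (n : ℕ) where
  /-- the positions `i_1, …, i_{n+1}` -/
  pos : Fin (n + 1) → ℕ
  /-- the split weights `s_1, …, s_{n+1}` -/
  split : Fin (n + 1) → ℝ
  pos_zero : pos 0 = 0
  pos_last : pos (Fin.last n) = m + 1
  pos_strictMono : StrictMono pos
  split_zero : split 0 = 0
  split_last : split (Fin.last n) = 0
  split_mem : ∀ j, split j ∈ Set.Icc 0 (labelled q (pos j))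

/-- `∑ j, p j • B(ε j)` is the channel `D_Q(i_2, …, i_n; s_2, …, s_n)` in `𝔹*_n` for
`Q = ∑ i, q i • B(σ i)` and the splitting patterns `T`: its `j`-th particle is compounded from the
`(i_j, i_{j+1}; s_j, s_{j+1})`-segment of `Q`. -/
structure IsSegmentCompound {m n : ℕ} (q : stdSimplex ℝ (Fin m)) (σ : Fin m → unitInterval)
    (T : SplittingPatterns q n) (p : stdSimplex ℝ (Fin n)) (ε : Fin n → unitInterval) : Prop where
  mem_star : bscMix p ε ∈ SymSetStar n
  compounded : ∀ j : Fin n, IsCompounded (p j) (ε j)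
    (Finset.Icc (T.pos j.castSucc) (T.pos j.succ))
    (segment q (T.pos j.castSucc) (T.pos j.succ) (T.split j.castSucc) (T.split j.succ))
    (labelled fun i => (σ i : ℝ))

end BIDMC

end

/-! ### Degradation, error probability and likelihood-ratio profiles -/

noncomputable section
namespace BIDMC

/-! Up to equivalence, all channels involved are mixtures of binary symmetric channels with
crossover probabilities at most 1/2. Between such mixtures degradation is a transport problem: `∑ p
j B(ε j)` is a degradation of `∑ q i B(σ i)` iff the weights `q i` can be distributed over cells of
weight `p j` so that no cell receives error mass above `p j * ε j`
(`exists_isCoupling_of_isDegradation`, `IsCoupling.isDegradation`).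

Lay the weights of `Q` side by side on `[0, 1]` in increasing order of `σ`. The least error mass of
a portion of weight `x` is `F x` (`lorenz`), a convex function that is affine with slope `σ i` on
the piece of label `i`. Cuts `0 = u 0 < ⋯ < u n = 1`, with each cell merged into one particle,
define a channel `D`: its weights are the cell lengths, its levels the slopes of the chords of `F`.
It has the form `D_Q(…)`, where `i_j` is a label whose piece contains the cut and `s_j` is the part
of that piece beyond the cut. Merging keeps the total error mass, so `D` has the error probability
of `Q`, which no degradation of `Q` can undercut. Hence `D` is a P-degradation of `Q` for any such
cuts.

To get `W ≼ D`, cut at the cumulative weights `v k` of `W`, its levels being sorted. A coupling of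
`W` with `Q` bounds `F (v k)` by the error mass of the first `k` cells of `W`. The polygon through
the graph of `F` at the cuts agrees with `F` at `v k`, so laying `D` along `W` in order respects all
partial sums; `exists_isCoupling_of_partial_sums` turns this into a coupling, cell by cell.

The `v k` may coincide or crowd into one piece. `exists_breakpoints` therefore replaces them by
exactly `n + 1` cuts, two of which lie in a common piece only as its two ends. A lost `v k` lies in
a piece whose ends are cuts; there `F` is affine, so the polygon still agrees with `F` at `v k`. The
same rule for pieces makes the slopes strictly increasing and gives the clauses on adjacent
positions and the lower bounds on weights. -/

theorem IsDegradation.trans {W₁ W₂ W₃ : BIDMC} (h₁ : W₁.IsDegradation W₂)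
    (h₂ : W₂.IsDegradation W₃) : W₁.IsDegradation W₃ := by
  obtain ⟨K, hK⟩ := h₁
  obtain ⟨L, hL⟩ := h₂
  exact ⟨fun y => (L y).bind K, fun x => by rw [hK, hL, PMF.bind_bind]⟩

/-- Pooling outputs can only increase the error, since a sum of minima is at most the minimum of the
sums. -/
theorem IsDegradation.errorProb_le {W' W : BIDMC} (h : W'.IsDegradation W) :
    W.errorProb ≤ W'.errorProb := by
  obtain ⟨K, hK⟩ := h
  refine mul_le_mul_right (?_ : _ ≤ _) _
  calc ∑' y, min (W.law 0 y) (W.law 1 y)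
      = ∑' y, ∑' z, min (W.law 0 y) (W.law 1 y) * K y z := by
        refine tsum_congr fun y => ?_
        rw [ENNReal.tsum_mul_left, (K y).tsum_coe, mul_one]
    _ = ∑' z, ∑' y, min (W.law 0 y) (W.law 1 y) * K y z := ENNReal.tsum_comm
    _ ≤ ∑' z, min (W'.law 0 z) (W'.law 1 z) := by
        refine ENNReal.tsum_le_tsum fun z => ?_
        rw [hK, hK, PMF.bind_apply, PMF.bind_apply]
        refine le_min ?_ ?_ <;> refine ENNReal.tsum_le_tsum fun y => ?_ <;> gcongr
        exacts [min_le_left _ _, min_le_right _ _]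

/-- A division-free form that also covers the infinite ratio; `a + b ≠ 0` excludes the convention `0
/ 0 = 0`. -/
theorem div_eq_ofReal_div_iff {a b : ℝ≥0∞} (ha : a ≠ ⊤) (hb : b ≠ ⊤) (hab : a + b ≠ 0)
    (e : unitInterval) :
    a / b = ENNReal.ofReal (e : ℝ) / ENNReal.ofReal (1 - (e : ℝ)) ↔
      a = (a + b) * ENNReal.ofReal (e : ℝ) ∧ b = (a + b) * ENNReal.ofReal (1 - (e : ℝ)) := by
  have h01 : ENNReal.ofReal (e : ℝ) + ENNReal.ofReal (1 - (e : ℝ)) = 1 := by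
    rw [← ENNReal.ofReal_add e.2.1 (sub_nonneg.2 e.2.2)]
    simp
  have hs : a + b ≠ ⊤ := by simp [ha, hb]
  constructor
  · intro h
    set x := ENNReal.ofReal (e : ℝ) with hx
    set y := ENNReal.ofReal (1 - (e : ℝ)) with hy
    have hxt : x ≠ ⊤ := ENNReal.ofReal_ne_top
    have hyt : y ≠ ⊤ := ENNReal.ofReal_ne_top
    have key : a * y = b * x := by
      rcases eq_or_ne b 0 with rfl | hb0
      · have ha0 : a ≠ 0 := by simpa using hab
        rw [ENNReal.div_zero ha0] at h
        have : y = 0 := by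
          by_contra hy0
          exact (ENNReal.div_lt_top hxt hy0).ne h.symm
        simp [this]
      · rcases eq_or_ne y 0 with hy0 | hy0
        · have hx0 : x ≠ 0 := by
            intro hx0
            simp [hx0, hy0] at h01
          rw [hy0, ENNReal.div_zero hx0] at h
          exact absurd h (ENNReal.div_lt_top ha hb0).ne
        · rw [ENNReal.div_eq_div_iff hy0 hyt hb0 hb] at h
          rw [mul_comm a, h]
    constructor
    · calc a = a * (x + y) := by rw [h01, mul_one]
        _ = (a + b) * x := by rw [mul_add, key, add_mul]
    · calc b = b * (x + y) := by rw [h01, mul_one]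
        _ = (a + b) * y := by rw [mul_add, ← key, add_mul]
  · rintro ⟨h1, h2⟩
    calc a / b = (a + b) * ENNReal.ofReal (e : ℝ) / ((a + b) * ENNReal.ofReal (1 - (e : ℝ))) := by
          rw [← h1, ← h2]
      _ = _ := ENNReal.mul_div_mul_left _ _ hab hs

/-- The probability of an output under the uniform input. -/
def mass (W : BIDMC) (y : W.Out) : ℝ≥0∞ := 2⁻¹ * (W.law 0 y + W.law 1 y)

theorem law_le_two_mul_mass (W : BIDMC) (x : ZMod 2) (y : W.Out) :
    W.law x y ≤ 2 * W.mass y := by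
  rw [mass, ← mul_assoc, ENNReal.mul_inv_cancel (by simp) (by simp), one_mul]
  fin_cases x
  exacts [le_self_add, le_add_self]

theorem tsum_mass (W : BIDMC) : ∑' y, W.mass y = 1 := by
  simp only [mass]
  rw [ENNReal.tsum_mul_left, ENNReal.tsum_add, PMF.tsum_coe, PMF.tsum_coe, one_add_one_eq_two,
    ENNReal.inv_mul_cancel (by simp) (by simp)]

theorem lrProfile_eq_tsum (W : BIDMC) (e : unitInterval) :
    W.lrProfile e = ∑' y, (W.lrSet e).indicator W.mass y := by
  rw [← tsum_subtype]
  rfl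

/-- The posterior probability of the input `x` when the likelihood ratio is `e / (1 - e)`. -/
def posterior (x : ZMod 2) (e : unitInterval) : ℝ≥0∞ :=
  if x = 0 then ENNReal.ofReal (e : ℝ) else ENNReal.ofReal (1 - (e : ℝ))

theorem law_add_ne_zero {W : BIDMC} {y : W.Out} (hy : W.mass y ≠ 0) :
    W.law 0 y + W.law 1 y ≠ 0 := by
  rintro h
  simp [mass, h] at hy

theorem law_eq_of_mem_lrSet {W : BIDMC} {y : W.Out} {e : unitInterval} (hy : W.mass y ≠ 0)
    (h : y ∈ W.lrSet e) (x : ZMod 2) : W.law x y = 2 * W.mass y * posterior x e := by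
  have h2 : 2 * W.mass y = W.law 0 y + W.law 1 y := by
    rw [mass, ← mul_assoc, ENNReal.mul_inv_cancel (by simp) (by simp), one_mul]
  have := (div_eq_ofReal_div_iff (PMF.apply_ne_top _ _) (PMF.apply_ne_top _ _)
    (law_add_ne_zero hy) e).1 h
  rw [h2]
  rcases (by decide : ∀ x : ZMod 2, x = 0 ∨ x = 1) x with rfl | rfl
  · simpa [posterior] using this.1
  · simpa [posterior] using this.2

theorem exists_mem_lrSet {W : BIDMC} (y : W.Out) (hy : W.mass y ≠ 0) : ∃ e, y ∈ W.lrSet e := by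
  have hs := law_add_ne_zero hy
  have ht : W.law 0 y + W.law 1 y ≠ ⊤ := by simp [PMF.apply_ne_top]
  set a := W.law 0 y
  set b := W.law 1 y
  have ha : a / (a + b) ≤ 1 := by
    refine ENNReal.div_le_of_le_mul ?_
    rw [one_mul]
    exact le_self_add
  have hat : a / (a + b) ≠ ⊤ := (ha.trans_lt ENNReal.one_lt_top).ne
  have hbt : b / (a + b) ≠ ⊤ := by
    refine ne_top_of_le_ne_top ENNReal.one_ne_top (ENNReal.div_le_of_le_mul ?_)
    rw [one_mul]
    exact le_add_self
  have hsum : (a / (a + b)).toReal + (b / (a + b)).toReal = 1 := by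
    rw [← ENNReal.toReal_add hat hbt, ENNReal.div_add_div_same, ENNReal.div_self hs ht]
    simp
  refine ⟨⟨(a / (a + b)).toReal, ENNReal.toReal_nonneg,
    by linarith [ENNReal.toReal_nonneg (a := b / (a + b))]⟩, ?_⟩
  refine (div_eq_ofReal_div_iff (PMF.apply_ne_top _ _) (PMF.apply_ne_top _ _) hs _).2 ⟨?_, ?_⟩
  · rw [ENNReal.ofReal_toReal hat, ENNReal.mul_div_cancel hs ht]
  · rw [← eq_sub_iff_add_eq'.2 hsum, ENNReal.ofReal_toReal hbt, ENNReal.mul_div_cancel hs ht]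

theorem lrSet_injective {W : BIDMC} {y : W.Out} (hy : W.mass y ≠ 0) {e e' : unitInterval}
    (h : y ∈ W.lrSet e) (h' : y ∈ W.lrSet e') : e = e' := by
  have hs := law_add_ne_zero hy
  have ht : W.law 0 y + W.law 1 y ≠ ⊤ := by simp [PMF.apply_ne_top]
  have h1 := ((div_eq_ofReal_div_iff (PMF.apply_ne_top _ _) (PMF.apply_ne_top _ _) hs _).1 h).1
  have h2 := ((div_eq_ofReal_div_iff (PMF.apply_ne_top _ _) (PMF.apply_ne_top _ _) hs _).1 h').1
  have h3 := (ENNReal.mul_right_inj hs ht).1 (h1.symm.trans h2)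
  exact Subtype.ext ((ENNReal.ofReal_eq_ofReal_iff e.2.1 e'.2.1).1 h3)

theorem lrProfile_ne_top (W : BIDMC) (e : unitInterval) : W.lrProfile e ≠ ⊤ := by
  rw [lrProfile_eq_tsum]
  refine ne_top_of_le_ne_top ENNReal.one_ne_top ?_
  rw [← W.tsum_mass]
  exact ENNReal.tsum_le_tsum fun y => Set.indicator_le_self _ _ _

theorem mass_le_lrProfile {W : BIDMC} {y : W.Out} {e : unitInterval} (h : y ∈ W.lrSet e) :
    W.mass y ≤ W.lrProfile e := by
  rw [lrProfile_eq_tsum]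
  refine le_trans ?_ (ENNReal.le_tsum y)
  rw [Set.indicator_of_mem h]

open Classical in
/-- The output distribution of `W` conditioned on the likelihood ratio `e / (1 - e)`. -/
def condLR (W : BIDMC) (e : unitInterval) : PMF W.Out :=
  if h : W.lrProfile e = 0 then W.law 0 else
    PMF.normalize ((W.lrSet e).indicator W.mass) (by rwa [← lrProfile_eq_tsum])
      (by rw [← lrProfile_eq_tsum]; exact W.lrProfile_ne_top e)

theorem condLR_apply {W : BIDMC} {e : unitInterval} (h : W.lrProfile e ≠ 0) (y : W.Out) :
    W.condLR e y = (W.lrSet e).indicator W.mass y * (W.lrProfile e)⁻¹ := by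
  rw [condLR, dif_neg h, PMF.normalize_apply, ← lrProfile_eq_tsum]

-- Given the likelihood ratio, the output is independent of the input. So `W` is simulated from `W'`
-- by reading off the ratio and drawing an output of `W` conditioned on it; equal profiles give the
-- ratio the right distribution.
open Classical in
theorem Equivalent.isDegradation {W W' : BIDMC} (h : W.Equivalent W') : W.IsDegradation W' := by
  refine ⟨fun o => if ho : W'.mass o = 0 then W.law 0 else
    W.condLR (exists_mem_lrSet o ho).choose, fun x => PMF.ext fun y => ?_⟩
  rw [PMF.bind_apply]
  rcases eq_or_ne (W.mass y) 0 with hy | hy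
  · have h0 : ∀ x, W.law x y = 0 := fun x => by
      have := W.law_le_two_mul_mass x y
      simpa [hy] using this
    rw [h0, eq_comm, ENNReal.tsum_eq_zero]
    intro o
    split_ifs with ho
    · rw [h0, mul_zero]
    · rw [condLR_apply]
      · rw [Set.indicator_apply_eq_zero.2 fun _ => hy, zero_mul, mul_zero]
      · rw [h]
        exact fun h0 => ho (le_zero_iff.1
          (h0 ▸ mass_le_lrProfile (exists_mem_lrSet o ho).choose_spec))
  · obtain ⟨e, he⟩ := exists_mem_lrSet y hy
    have hP : W.lrProfile e ≠ 0 := fun h0 => hy (le_zero_iff.1 (h0 ▸ mass_le_lrProfile he))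
    have hterm : ∀ o, W'.law x o * (if ho : W'.mass o = 0 then W.law 0 else
        W.condLR (exists_mem_lrSet o ho).choose) y =
        (W'.lrSet e).indicator W'.mass o * (2 * posterior x e * W.mass y * (W.lrProfile e)⁻¹) := by
      intro o
      split_ifs with ho
      · have h0 : W'.law x o = 0 := by
          have := W'.law_le_two_mul_mass x o
          simpa [ho] using this
        rw [h0, Set.indicator_apply_eq_zero.2 fun _ => ho, zero_mul, zero_mul]
      · have hs := (exists_mem_lrSet o ho).choose_spec
        set e' := (exists_mem_lrSet o ho).choose
        have hP' : W.lrProfile e' ≠ 0 := by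
          rw [h]
          exact fun h0 => ho (le_zero_iff.1 (h0 ▸ mass_le_lrProfile hs))
        rw [condLR_apply hP']
        by_cases hee : e' = e
        · rw [hee] at hs ⊢
          rw [Set.indicator_of_mem he, Set.indicator_of_mem hs, law_eq_of_mem_lrSet ho hs]
          ring
        · rw [Set.indicator_of_notMem (fun hy' => hee (lrSet_injective hy hy' he)),
            Set.indicator_of_notMem (fun ho' => hee (lrSet_injective ho hs ho'))]
          simp
    rw [tsum_congr hterm, ENNReal.tsum_mul_right, ← lrProfile_eq_tsum, ← h,
      law_eq_of_mem_lrSet hy he]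
    calc 2 * W.mass y * posterior x e
        = (W.lrProfile e * (W.lrProfile e)⁻¹) * (2 * W.mass y * posterior x e) := by
          rw [ENNReal.mul_inv_cancel hP (W.lrProfile_ne_top e), one_mul]
      _ = _ := by ring

theorem Equivalent.symm {W W' : BIDMC} (h : W.Equivalent W') : W'.Equivalent W :=
  fun e => (h e).symm

theorem Equivalent.trans {W₁ W₂ W₃ : BIDMC} (h₁ : W₁.Equivalent W₂) (h₂ : W₂.Equivalent W₃) :
    W₁.Equivalent W₃ :=
  fun e => (h₁ e).trans (h₂ e)

theorem Equivalent.errorProb_eq {W W' : BIDMC} (h : W.Equivalent W') :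
    W.errorProb = W'.errorProb :=
  le_antisymm h.symm.isDegradation.errorProb_le h.isDegradation.errorProb_le

end BIDMC
end

/-! ### Mixtures of binary symmetric channels -/

noncomputable section
namespace BIDMC

theorem weight_nonneg {n : ℕ} (p : stdSimplex ℝ (Fin n)) (j : Fin n) : 0 ≤ p j := p.2.1 j

theorem sum_weight {n : ℕ} (p : stdSimplex ℝ (Fin n)) : ∑ j, p j = 1 := p.2.2

theorem zmod_two_cases (b : ZMod 2) : b = 0 ∨ b = 1 := by
  revert b
  decide

/-- The output `b` of the `j`-th sub-channel of a mixture of binary symmetric channels. -/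
def mixOut {n : ℕ} (p : stdSimplex ℝ (Fin n)) (ε : Fin n → unitInterval) (j : Fin n) (b : ZMod 2) :
    (bscMix p ε).Out :=
  Sigma.mk (β := fun j => (bsc (ε j)).Out) j b

theorem exists_eq_mixOut {n : ℕ} {p : stdSimplex ℝ (Fin n)} {ε : Fin n → unitInterval}
    (o : (bscMix p ε).Out) : ∃ j b, o = mixOut p ε j b :=
  ⟨o.1, o.2, rfl⟩

theorem tsum_bscMix {n : ℕ} (p : stdSimplex ℝ (Fin n)) (ε : Fin n → unitInterval)
    (f : (bscMix p ε).Out → ℝ≥0∞) :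
    ∑' o, f o = ∑ j, (f (mixOut p ε j 0) + f (mixOut p ε j 1)) := by
  refine (ENNReal.tsum_sigma' (β := fun _ : Fin n => ZMod 2) f).trans ?_
  rw [tsum_fintype]
  refine Finset.sum_congr rfl fun j _ => ?_
  rw [tsum_fintype]
  exact Fin.sum_univ_two _

/-- The transition probabilities of a binary symmetric channel. -/
def flipProb (e : ℝ) (x b : ZMod 2) : ℝ := if b = x then 1 - e else e

theorem flipProb_nonneg (e : unitInterval) (x b : ZMod 2) : 0 ≤ flipProb e x b := by
  unfold flipProb
  split_ifs
  exacts [sub_nonneg.2 e.2.2, e.2.1]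

theorem weightPMF_apply {n : ℕ} (p : stdSimplex ℝ (Fin n)) (j : Fin n) :
    weightPMF p j = ENNReal.ofReal (p j) := rfl

theorem bsc_law (e : unitInterval) (x b : ZMod 2) :
    (bsc e).law x b = ENNReal.ofReal (flipProb e x b) := by
  change (if b = x then _ else _) = _
  unfold flipProb
  split_ifs <;> rfl

theorem bscMix_law {n : ℕ} (p : stdSimplex ℝ (Fin n)) (ε : Fin n → unitInterval) (x : ZMod 2)
    (j : Fin n) (b : ZMod 2) :
    (bscMix p ε).law x (mixOut p ε j b) = ENNReal.ofReal (p j * flipProb (ε j) x b) := by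
  change ((weightPMF p).bind fun i => ((bsc (ε i)).law x).map (Sigma.mk i))
    (Sigma.mk (β := fun j => (bsc (ε j)).Out) j b) = _
  rw [PMF.bind_apply, tsum_eq_single j]
  · rw [PMF.map_apply]
    refine (congrArg _ (tsum_eq_single (β := (bsc (ε j)).Out) b ?_)).trans ?_
    · intro b' hb'
      rw [if_neg]
      intro h
      exact hb' (eq_of_heq (Sigma.mk.inj h).2).symm
    · refine (congrArg _ (if_pos rfl)).trans ?_
      rw [bsc_law, weightPMF_apply, ENNReal.ofReal_mul (weight_nonneg p j)]
  · intro i hi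
    rw [PMF.map_apply, ENNReal.tsum_eq_zero.2, mul_zero]
    intro b'
    rw [if_neg]
    intro h
    exact hi (Sigma.mk.inj h).1.symm

theorem bscMix_mass {n : ℕ} (p : stdSimplex ℝ (Fin n)) (ε : Fin n → unitInterval)
    (j : Fin n) (b : ZMod 2) :
    (bscMix p ε).mass (mixOut p ε j b) = ENNReal.ofReal (p j / 2) := by
  change 2⁻¹ * ((bscMix p ε).law 0 _ + (bscMix p ε).law 1 _) = _
  rw [bscMix_law, bscMix_law, ← ENNReal.ofReal_add
    (mul_nonneg (weight_nonneg p j) (flipProb_nonneg _ _ _)) (mul_nonneg (weight_nonneg p j) (flipProb_nonneg _ _ _)),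
    div_eq_inv_mul, ENNReal.ofReal_mul (by norm_num), ENNReal.ofReal_inv_of_pos (by norm_num)]
  congr 2
  · simp
  · rcases zmod_two_cases b with rfl | rfl <;> simp [flipProb] <;> ring

theorem bscMix_mem_lrSet {n : ℕ} {p : stdSimplex ℝ (Fin n)} {ε : Fin n → unitInterval}
    {j : Fin n} (hj : p j ≠ 0) (b : ZMod 2) :
    mixOut p ε j b ∈
      (bscMix p ε).lrSet (if b = 0 then unitInterval.symm (ε j) else ε j) := by
  have h0 : ENNReal.ofReal (p j) ≠ 0 := by
    rw [Ne, ENNReal.ofReal_eq_zero, not_le]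
    exact lt_of_le_of_ne (weight_nonneg p j) hj.symm
  change (bscMix p ε).law 0 (mixOut p ε j b) / (bscMix p ε).law 1 (mixOut p ε j b) = _
  rw [bscMix_law, bscMix_law, ENNReal.ofReal_mul (weight_nonneg p j), ENNReal.ofReal_mul (weight_nonneg p j),
    ENNReal.mul_div_mul_left _ _ h0 ENNReal.ofReal_ne_top]
  rcases zmod_two_cases b with rfl | rfl <;> simp [flipProb]

open Classical in
theorem bscMix_lrProfile {n : ℕ} (p : stdSimplex ℝ (Fin n)) (ε : Fin n → unitInterval)
    (e : unitInterval) :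
    (bscMix p ε).lrProfile e =
      ∑ j, ((if unitInterval.symm (ε j) = e then ENNReal.ofReal (p j / 2) else 0) +
        (if ε j = e then ENNReal.ofReal (p j / 2) else 0)) := by
  rw [lrProfile_eq_tsum, tsum_bscMix]
  refine Finset.sum_congr rfl fun j _ => ?_
  have key : ∀ b : ZMod 2, ((bscMix p ε).lrSet e).indicator (bscMix p ε).mass (mixOut p ε j b) =
      if (if b = 0 then unitInterval.symm (ε j) else ε j) = e then
        ENNReal.ofReal (p j / 2) else 0 := by
    intro b
    rw [Set.indicator_apply, bscMix_mass]
    by_cases hj : p j = 0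
    · simp [hj]
    · have hm := bscMix_mem_lrSet (ε := ε) hj b
      have hne : (bscMix p ε).mass (mixOut p ε j b) ≠ 0 := by
        rw [bscMix_mass, Ne, ENNReal.ofReal_eq_zero, not_le]
        exact half_pos (lt_of_le_of_ne (weight_nonneg p j) (Ne.symm hj))
      exact if_congr ⟨fun h => lrSet_injective hne hm h, fun h => h ▸ hm⟩ rfl rfl
  rw [key, key, if_pos rfl, if_neg one_ne_zero]

theorem bscMix_mem_symSet {n : ℕ} (p : stdSimplex ℝ (Fin n)) (ε : Fin n → unitInterval) :
    bscMix p ε ∈ SymSet n := ⟨p, ε, fun _ => rfl⟩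

theorem bscMix_equivalent_of_perm {n : ℕ} {p p' : stdSimplex ℝ (Fin n)}
    {ε ε' : Fin n → unitInterval} (s : Equiv.Perm (Fin n)) (hp : ∀ j, p' j = p (s j))
    (hε : ∀ j, ε' j = ε (s j) ∨ ε' j = unitInterval.symm (ε (s j))) :
    (bscMix p ε).Equivalent (bscMix p' ε') := by
  intro e
  rw [bscMix_lrProfile, bscMix_lrProfile, ← Equiv.sum_comp s]
  refine Finset.sum_congr rfl fun j _ => ?_
  rw [hp]
  rcases hε j with h | h
  · rw [h]
  · rw [h, unitInterval.symm_symm, add_comm]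

/-- `B(ε)` and `B(1 - ε)` have the same profile, so every level can be folded into `[0, 1/2]`, and
the levels can then be sorted. -/
theorem exists_monotone_bscMix {n : ℕ} {W : BIDMC} (hW : W ∈ SymSet n) :
    ∃ (p : stdSimplex ℝ (Fin n)) (ε : Fin n → unitInterval),
      W.Equivalent (bscMix p ε) ∧ Monotone ε ∧ ∀ j, (ε j : ℝ) ≤ 1 / 2 := by
  obtain ⟨p, ε, h⟩ := hW
  let f : Fin n → unitInterval := fun j => min (ε j) (unitInterval.symm (ε j))
  let s := Tuple.sort f
  let p' : stdSimplex ℝ (Fin n) := ⟨fun j => p (s j), fun j => p.2.1 _, by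
    rw [Equiv.sum_comp s (fun j => p j)]; exact sum_weight p⟩
  refine ⟨p', f ∘ s, h.trans (bscMix_equivalent_of_perm s (fun _ => rfl) fun j => min_choice _ _),
    Tuple.monotone_sort f, fun j => ?_⟩
  have h1 : (f (s j) : ℝ) ≤ ε (s j) := min_le_left _ _
  have h2 : (f (s j) : ℝ) ≤ 1 - ε (s j) := min_le_right (ε (s j)) (unitInterval.symm (ε (s j)))
  change (f (s j) : ℝ) ≤ 1 / 2
  linarith

theorem bscMix_errorProb {n : ℕ} (p : stdSimplex ℝ (Fin n)) {ε : Fin n → unitInterval}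
    (hε : ∀ j, (ε j : ℝ) ≤ 1 / 2) :
    (bscMix p ε).errorProb = ENNReal.ofReal (∑ j, p j * ε j) := by
  have key : ∀ j, ∀ b : ZMod 2,
      min ((bscMix p ε).law 0 (mixOut p ε j b)) ((bscMix p ε).law 1 (mixOut p ε j b)) =
        ENNReal.ofReal (p j * ε j) := by
    intro j b
    have h1 : p j * (ε j : ℝ) ≤ p j * (1 - ε j) :=
      mul_le_mul_of_nonneg_left (by linarith [hε j]) (weight_nonneg p j)
    rw [bscMix_law, bscMix_law]
    rcases zmod_two_cases b with rfl | rfl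
    · simpa [flipProb] using ENNReal.ofReal_le_ofReal h1
    · simpa [flipProb] using ENNReal.ofReal_le_ofReal h1
  rw [errorProb, tsum_bscMix]
  simp only [key, ← two_mul]
  rw [← Finset.mul_sum, ← mul_assoc, ENNReal.inv_mul_cancel (by simp) (by simp), one_mul,
    ENNReal.ofReal_sum_of_nonneg fun j _ => mul_nonneg (weight_nonneg p j) (ε j).2.1]

/-- A particle of weight zero could be dropped without changing the profile, leaving a mixture of `m
- 1` channels. -/
theorem pos_of_mem_symSetStar {m : ℕ} {q : stdSimplex ℝ (Fin m)} {σ : Fin m → unitInterval}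
    {Q : BIDMC} (hQ : Q.Equivalent (bscMix q σ)) (h : Q ∈ SymSetStar m) (i : Fin m) :
    0 < q i := by
  refine lt_of_le_of_ne (q.2.1 i) fun h0 => h.2 ?_
  obtain ⟨k, rfl⟩ : ∃ k, m = k + 1 := ⟨m - 1, by have := i.2; omega⟩
  have hs : ∑ j : Fin k, q (i.succAbove j) = 1 := by
    have := sum_weight q
    rw [Fin.sum_univ_succAbove _ i] at this
    linarith
  refine ⟨⟨fun j => q (i.succAbove j), fun j => q.2.1 _, hs⟩, fun j => σ (i.succAbove j),
    hQ.trans fun e => ?_⟩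
  rw [bscMix_lrProfile, bscMix_lrProfile, Fin.sum_univ_succAbove _ i, ← h0]
  simp only [zero_div, ENNReal.ofReal_zero, ite_self, add_zero, zero_add]
  rfl

/-- Each of the `n` distinct levels carries mass in the profile, so it is the folded level of some
particle of any equivalent mixture; `n - 1` particles are too few. -/
theorem bscMix_mem_symSetStar {n : ℕ} (hn : 0 < n) {p : stdSimplex ℝ (Fin n)}
    {ε : Fin n → unitInterval} (hp : ∀ j, 0 < p j) (hε : StrictMono ε)
    (hhalf : ∀ j, (ε j : ℝ) ≤ 1 / 2) : bscMix p ε ∈ SymSetStar n := by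
  refine ⟨bscMix_mem_symSet p ε, ?_⟩
  rintro ⟨p', ε', h⟩
  have key : ∀ j, ∃ i, min (ε' i) (unitInterval.symm (ε' i)) = ε j := by
    intro j
    by_contra! hne
    have h1 := h (ε j)
    rw [bscMix_lrProfile, bscMix_lrProfile] at h1
    have h2 : ∀ i, unitInterval.symm (ε' i) ≠ ε j ∧ ε' i ≠ ε j := by
      intro i
      have hi : (min (ε' i) (unitInterval.symm (ε' i))) ≠ ε j := hne i
      constructor
      · intro h3
        refine hi ?_
        rw [h3, min_eq_right]
        have : (1 : ℝ) - ε' i = ε j := congrArg Subtype.val h3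
        have := hhalf j
        exact Subtype.coe_le_coe.1 (by linarith)
      · intro h3
        refine hi ?_
        rw [h3, min_eq_left]
        have := hhalf j
        refine Subtype.coe_le_coe.1 ?_
        change (ε j : ℝ) ≤ 1 - ε j
        linarith
    have h3 : ∑ i, ((if unitInterval.symm (ε' i) = ε j then ENNReal.ofReal (p' i / 2) else 0) +
        (if ε' i = ε j then ENNReal.ofReal (p' i / 2) else 0)) = 0 :=
      Finset.sum_eq_zero fun i _ => by rw [if_neg (h2 i).1, if_neg (h2 i).2, add_zero]
    rw [h3] at h1
    have h4 := (Finset.sum_eq_zero_iff.1 h1) j (Finset.mem_univ j)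
    rw [if_pos rfl, add_eq_zero, ENNReal.ofReal_eq_zero] at h4
    linarith [hp j, h4.2]
  choose g hg using key
  have hinj : Function.Injective g := fun a b hab => hε.injective (by rw [← hg a, ← hg b, hab])
  have := Fintype.card_le_of_injective g hinj
  simp only [Fintype.card_fin] at this
  omega

end BIDMC
end

/-! ### Degradation as a transport problem -/

noncomputable section
namespace BIDMC

/-- `t` distributes the particles `q i • B(σ i)` over the particles `p j • B(ε j)` in such a way that
the error probability of none of the latter is exceeded. -/
structure IsCoupling {n m : ℕ} (p ε : Fin n → ℝ) (q σ : Fin m → ℝ) (t : Fin n → Fin m → ℝ) :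
    Prop where
  nonneg : ∀ j i, 0 ≤ t j i
  sum_right : ∀ j, ∑ i, t j i = p j
  sum_left : ∀ i, ∑ j, t j i = q i
  sum_mul_le : ∀ j, ∑ i, t j i * σ i ≤ p j * ε j

theorem exists_isCoupling_of_isDegradation {n m : ℕ} {p : stdSimplex ℝ (Fin n)}
    {ε : Fin n → unitInterval} {q : stdSimplex ℝ (Fin m)} {σ : Fin m → unitInterval}
    (hσ : ∀ i, (σ i : ℝ) ≤ 1 / 2) (h : (bscMix p ε).IsDegradation (bscMix q σ)) :
    ∃ t, IsCoupling p (fun j => (ε j : ℝ)) q (fun i => (σ i : ℝ)) t := by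
  obtain ⟨K, hK⟩ := h
  let k : Fin m → ZMod 2 → Fin n → ZMod 2 → ℝ := fun i b j c =>
    (K (mixOut q σ i b) (mixOut p ε j c)).toReal
  have hk0 : ∀ i b j c, 0 ≤ k i b j c := fun _ _ _ _ => ENNReal.toReal_nonneg
  have hk1 : ∀ i b, ∑ j, (k i b j 0 + k i b j 1) = 1 := by
    intro i b
    have h1 := (K (mixOut q σ i b)).tsum_coe
    rw [tsum_bscMix] at h1
    have h2 := congrArg ENNReal.toReal h1
    rw [ENNReal.toReal_sum (fun j _ => by simp [PMF.apply_ne_top])] at h2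
    rw [← ENNReal.toReal_one, ← h2]
    refine Finset.sum_congr rfl fun j _ => ?_
    rw [ENNReal.toReal_add (PMF.apply_ne_top _ _) (PMF.apply_ne_top _ _)]
  have hlaw : ∀ x j c, p j * flipProb (ε j) x c =
      ∑ i, (q i * flipProb (σ i) x 0 * k i 0 j c + q i * flipProb (σ i) x 1 * k i 1 j c) := by
    intro x j c
    have h1 : (bscMix p ε).law x (mixOut p ε j c) = _ :=
      congrArg (fun f => f (mixOut p ε j c)) (hK x)
    rw [PMF.bind_apply, tsum_bscMix, bscMix_law] at h1
    simp only [bscMix_law] at h1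
    have h2 := congrArg ENNReal.toReal h1
    have hq : ∀ i b, 0 ≤ q i * flipProb (σ i) x b := fun i b =>
      mul_nonneg (weight_nonneg q i) (flipProb_nonneg _ _ _)
    rw [ENNReal.toReal_ofReal (mul_nonneg (weight_nonneg p j) (flipProb_nonneg _ _ _)),
      ENNReal.toReal_sum (fun i _ => by
        simp [PMF.apply_ne_top, ENNReal.mul_eq_top])] at h2
    rw [h2]
    refine Finset.sum_congr rfl fun i _ => ?_
    rw [ENNReal.toReal_add (ENNReal.mul_ne_top ENNReal.ofReal_ne_top (PMF.apply_ne_top _ _))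
      (ENNReal.mul_ne_top ENNReal.ofReal_ne_top (PMF.apply_ne_top _ _)), ENNReal.toReal_mul,
      ENNReal.toReal_mul, ENNReal.toReal_ofReal (hq _ _), ENNReal.toReal_ofReal (hq _ _)]
  -- The weight of label `i` times the probability of landing in sub-channel `j`, averaged over the
  -- two outputs of `B(σ i)`.
  refine ⟨fun j i => q i * (k i 0 j 0 + k i 0 j 1 + k i 1 j 0 + k i 1 j 1) / 2, ?_, ?_, ?_, ?_⟩
  · intro j i
    have := weight_nonneg q i
    have := hk0 i 0 j 0
    have := hk0 i 0 j 1
    have := hk0 i 1 j 0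
    have := hk0 i 1 j 1
    positivity
  · intro j
    have h00 := hlaw 0 j 0
    have h01 := hlaw 0 j 1
    have h10 := hlaw 1 j 0
    have h11 := hlaw 1 j 1
    have h2 : p j = (p j * flipProb (ε j) 0 0 + p j * flipProb (ε j) 0 1 +
        p j * flipProb (ε j) 1 0 + p j * flipProb (ε j) 1 1) / 2 := by
      simp [flipProb]; ring
    rw [h2, h00, h01, h10, h11, ← Finset.sum_add_distrib, ← Finset.sum_add_distrib,
      ← Finset.sum_add_distrib, Finset.sum_div]
    refine Finset.sum_congr rfl fun i _ => ?_
    simp [flipProb]; ring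
  · intro i
    have h0 := hk1 i 0
    have h1 := hk1 i 1
    calc _ = q i / 2 * (∑ j, (k i 0 j 0 + k i 0 j 1) + ∑ j, (k i 1 j 0 + k i 1 j 1)) := by
          rw [← Finset.sum_add_distrib, Finset.mul_sum]
          refine Finset.sum_congr rfl fun j _ => ?_
          ring
      _ = q i := by rw [h0, h1]; ring
  · intro j
    have h01 := hlaw 0 j 1
    have h10 := hlaw 1 j 0
    have h2 : p j * (ε j : ℝ) = (p j * flipProb (ε j) 0 1 + p j * flipProb (ε j) 1 0) / 2 := by
      simp [flipProb]
    rw [h2, h01, h10, ← Finset.sum_add_distrib, Finset.sum_div]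
    refine Finset.sum_le_sum fun i _ => ?_
    have hq := weight_nonneg q i
    -- The intermediate channel may flip the bit, which replaces `σ i` by `1 - σ i`; since `σ i ≤ 1
    -- / 2`, this only adds error mass.
    have ha := mul_nonneg (mul_nonneg hq (hk0 i 0 j 1)) (by linarith [hσ i] : 0 ≤ 1 - 2 * (σ i : ℝ))
    have hb := mul_nonneg (mul_nonneg hq (hk0 i 1 j 0)) (by linarith [hσ i] : 0 ≤ 1 - 2 * (σ i : ℝ))
    simp [flipProb]
    nlinarith

/-- Extra noise raises the error mass of a cell of weight `P` continuously from `X` to `P / 2`. -/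
theorem exists_noise {X Y P : ℝ} (hXY : X ≤ Y) (hY : Y ≤ P / 2) :
    ∃ δ : unitInterval, Y = X * (1 - δ) + (P - X) * δ := by
  rcases eq_or_ne (P - 2 * X) 0 with h | h
  · exact ⟨0, by simp; linarith⟩
  · have hpos : 0 < P - 2 * X := lt_of_le_of_ne (by linarith) h.symm
    refine ⟨⟨(Y - X) / (P - 2 * X), div_nonneg (by linarith) hpos.le,
      (div_le_one hpos).2 (by linarith)⟩, ?_⟩
    have h1 : (Y - X) / (P - 2 * X) * (P - 2 * X) = Y - X := div_mul_cancel₀ _ h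
    change Y = X * (1 - (Y - X) / (P - 2 * X)) + (P - X) * ((Y - X) / (P - 2 * X))
    linarith

theorem IsCoupling.isDegradation {n m : ℕ} {p : stdSimplex ℝ (Fin n)}
    {ε : Fin n → unitInterval} {q : stdSimplex ℝ (Fin m)} {σ : Fin m → unitInterval}
    (hε : ∀ j, (ε j : ℝ) ≤ 1 / 2) {t : Fin n → Fin m → ℝ}
    (h : IsCoupling p (fun j => (ε j : ℝ)) q (fun i => (σ i : ℝ)) t) :
    (bscMix p ε).IsDegradation (bscMix q σ) := by
  have hnoise : ∀ j, ∃ δ : unitInterval, p j * (ε j : ℝ) =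
      (∑ i, t j i * σ i) * (1 - δ) + (p j - ∑ i, t j i * σ i) * δ := fun j =>
    exists_noise (h.sum_mul_le j) (by
      have := mul_le_mul_of_nonneg_left (hε j) (weight_nonneg p j)
      linarith)
  choose δ hδ using hnoise
  have hw : ∀ i, ∃ w : stdSimplex ℝ (Fin n), ∀ j, q i * w j = t j i := by
    intro i
    rcases eq_or_ne (q i) 0 with h0 | h0
    -- A label of weight zero may be distributed arbitrarily; `p` serves as a default.
    · refine ⟨p, fun j => ?_⟩
      have h1 := h.sum_left i
      rw [h0, Finset.sum_eq_zero_iff_of_nonneg fun j _ => h.nonneg j i] at h1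
      rw [h0, zero_mul, h1 j (Finset.mem_univ j)]
    · refine ⟨⟨fun j => t j i / q i, fun j => div_nonneg (h.nonneg j i) (weight_nonneg q i), ?_⟩,
        fun j => mul_div_cancel₀ _ h0⟩
      rw [← Finset.sum_div, h.sum_left, div_self h0]
  choose w hw using hw
  -- From an output of label `i`, choose the cell `j` with probability `w i j`, then pass the bit
  -- through `B(δ j)`, which fills the cell up to error mass exactly `p j * ε j`.
  let K : (bscMix q σ).Out → PMF (bscMix p ε).Out := fun o => (bscMix (w o.1) δ).law o.2
  have hKapp : ∀ i b j c, K (mixOut q σ i b) (mixOut p ε j c) =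
      ENNReal.ofReal (w i j * flipProb (δ j) b c) := fun i b j c => bscMix_law (w i) δ b j c
  refine ⟨K, fun x => PMF.ext fun o => ?_⟩
  obtain ⟨j, c, rfl⟩ := exists_eq_mixOut o
  rw [PMF.bind_apply, tsum_bscMix, bscMix_law]
  simp only [bscMix_law, hKapp]
  have hnn : ∀ i b, 0 ≤ q i * flipProb (σ i) x b := fun i b =>
    mul_nonneg (weight_nonneg q i) (flipProb_nonneg _ _ _)
  have hnn' : ∀ i b, 0 ≤ w i j * flipProb (δ j) b c := fun i b =>
    mul_nonneg (weight_nonneg (w i) j) (flipProb_nonneg _ _ _)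
  simp only [← ENNReal.ofReal_mul (hnn _ _)]
  simp only [← ENNReal.ofReal_add (mul_nonneg (hnn _ _) (hnn' _ _))
    (mul_nonneg (hnn _ _) (hnn' _ _))]
  rw [← ENNReal.ofReal_sum_of_nonneg fun i _ => add_nonneg (mul_nonneg (hnn _ _) (hnn' _ _))
    (mul_nonneg (hnn _ _) (hnn' _ _))]
  congr 1
  have hexp : ∀ i, q i * flipProb (σ i) x 0 * (w i j * flipProb (δ j) 0 c) +
      q i * flipProb (σ i) x 1 * (w i j * flipProb (δ j) 1 c) =
      t j i * flipProb (σ i) x 0 * flipProb (δ j) 0 c +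
      t j i * flipProb (σ i) x 1 * flipProb (δ j) 1 c := fun i => by
    rw [← hw i j]; ring
  simp only [hexp]
  have hd := hδ j
  have hs := h.sum_right j
  have hflip : ∀ b, ∑ i, t j i * flipProb (σ i) x b =
      if b = x then p j - ∑ i, t j i * σ i else ∑ i, t j i * σ i := by
    intro b
    unfold flipProb
    split_ifs
    · simp only [mul_sub, mul_one, Finset.sum_sub_distrib, hs]
    · rfl
  rw [Finset.sum_add_distrib, ← Finset.sum_mul, ← Finset.sum_mul, hflip, hflip]
  rcases zmod_two_cases x with rfl | rfl <;> rcases zmod_two_cases c with rfl | rfl <;>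
    simp [flipProb] <;> linarith

end BIDMC


/-! ### From partial sums to cellwise bounds -/

/-- Abel summation. The bound `b` is there for the induction, where it becomes the last value of
`g`. -/
theorem mul_sum_le_sum_mul_of_partial_sums_nonpos {n : ℕ} {g d : Fin n → ℝ} {b : ℝ}
    (hg : Monotone g) (hb : ∀ j, g j ≤ b)
    (hd : ∀ k ≤ n, ∑ j : Fin n with j.1 < k, d j ≤ 0) : b * ∑ j, d j ≤ ∑ j, g j * d j := by
  induction n generalizing b with
  | zero => simp
  | succ n ih =>
    have htot : ∑ j, d j ≤ 0 := by
      refine le_of_eq_of_le ?_ (hd (n + 1) le_rfl)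
      rw [Finset.filter_true_of_mem fun j _ => j.2]
    have h1 := ih (g := g ∘ Fin.castSucc) (d := d ∘ Fin.castSucc) (b := g (Fin.last n))
      (hg.comp Fin.strictMono_castSucc.monotone) (fun j => hg (Fin.le_last _)) (fun k hk => by
        refine le_of_eq_of_le ?_ (hd k (by omega))
        rw [Finset.sum_filter, Finset.sum_filter, Fin.sum_univ_castSucc]
        simp [hk])
    rw [Fin.sum_univ_castSucc] at htot ⊢
    rw [Fin.sum_univ_castSucc (f := fun j => g j * d j)]
    have h2 := mul_le_mul_of_nonpos_right (hb (Fin.last n)) htot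
    simp only [Function.comp_apply] at h1
    nlinarith

/-- A form of Farkas' lemma for transport plans: if the particles with weights `r` and values `h` can
be distributed by `t` over cells of weights `p` and nondecreasing levels `e` so that all partial sums
are at most those of `p * e`, then they can be distributed so that this holds for every cell. -/
theorem exists_isCoupling_of_partial_sums {n k : ℕ} {p e : Fin n → ℝ} {r h : Fin k → ℝ}
    {t : Fin n → Fin k → ℝ} (ht : ∀ j c, 0 ≤ t j c) (htp : ∀ j, ∑ c, t j c = p j)
    (htr : ∀ c, ∑ j, t j c = r c) (he : Monotone e)
    (hpart : ∀ l ≤ n, ∑ j : Fin n with j.1 < l, ∑ c, t j c * h c ≤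
      ∑ j : Fin n with j.1 < l, p j * e j) :
    ∃ M, BIDMC.IsCoupling p e r h M := by
  -- `Φ` records the weight and the error mass of each cell under a plan. The plans form a compact
  -- convex set, and `C` is the closed convex set of acceptable records; if its image under `Φ`
  -- misses `C`, a linear functional separates them.
  let Φ : (Fin n → Fin k → ℝ) →ₗ[ℝ] (Fin n → ℝ) × (Fin n → ℝ) :=
    { toFun := fun M => (fun j => ∑ c, M j c, fun j => ∑ c, M j c * h c)
      map_add' := fun M N => by
        ext j <;> simp [Finset.sum_add_distrib, add_mul]
      map_smul' := fun a M => by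
        ext j <;> simp [Finset.mul_sum, mul_assoc] }
  let S : Set (Fin n → Fin k → ℝ) := {M | (∀ j c, 0 ≤ M j c) ∧ ∀ c, ∑ j, M j c = r c}
  let C : Set ((Fin n → ℝ) × (Fin n → ℝ)) := {z | z.1 = p ∧ ∀ j, z.2 j ≤ p j * e j}
  have hSc : IsCompact S := by
    refine IsCompact.of_isClosed_subset
      (isCompact_Icc (a := (0 : Fin n → Fin k → ℝ)) (b := fun _ c => r c)) ?_ ?_
    · have h1 : S = (⋂ j, ⋂ c, {M | 0 ≤ M j c}) ∩ ⋂ c, {M | ∑ j, M j c = r c} := by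
        ext
        simp [S]
      rw [h1]
      exact (isClosed_iInter fun j => isClosed_iInter fun c =>
          isClosed_le continuous_const (by fun_prop)).inter
        (isClosed_iInter fun c => isClosed_eq (by fun_prop) continuous_const)
    · rintro M ⟨h0, h1⟩
      refine ⟨fun j c => h0 j c, fun j c => ?_⟩
      refine le_of_le_of_eq ?_ (h1 c)
      exact Finset.single_le_sum (f := fun j => M j c) (fun j _ => h0 j c) (Finset.mem_univ j)
  have hSx : Convex ℝ S := by
    rintro M ⟨hM0, hM1⟩ N ⟨hN0, hN1⟩ a b ha hb hab
    refine ⟨fun j c => add_nonneg (mul_nonneg ha (hM0 j c)) (mul_nonneg hb (hN0 j c)), fun c => ?_⟩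
    simp only [Pi.add_apply, Pi.smul_apply, smul_eq_mul, Finset.sum_add_distrib, ← Finset.mul_sum,
      hM1, hN1, ← add_mul, hab, one_mul]
  have hCc : IsClosed C := by
    have h1 : C = {z | z.1 = p} ∩ ⋂ j, {z | z.2 j ≤ p j * e j} := by
      ext
      simp [C]
    rw [h1]
    exact (isClosed_eq continuous_fst continuous_const).inter
      (isClosed_iInter fun j => isClosed_le (by fun_prop) continuous_const)
  have hCx : Convex ℝ C := by
    rintro z ⟨hz0, hz1⟩ w ⟨hw0, hw1⟩ a b ha hb hab
    refine ⟨?_, fun j => ?_⟩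
    · rw [Prod.fst_add, Prod.smul_fst, Prod.smul_fst, hz0, hw0, ← add_smul, hab, one_smul]
    · have h1 := mul_le_mul_of_nonneg_left (hz1 j) ha
      have h2 := mul_le_mul_of_nonneg_left (hw1 j) hb
      calc a * z.2 j + b * w.2 j ≤ a * (p j * e j) + b * (p j * e j) := add_le_add h1 h2
        _ = p j * e j := by rw [← add_mul, hab, one_mul]
  by_cases hdisj : Disjoint (Φ '' S) C
  swap
  · obtain ⟨z, ⟨M, hM, rfl⟩, hz⟩ := Set.not_disjoint_iff.1 hdisj
    exact ⟨M, hM.1, fun j => congrFun hz.1 j, hM.2, hz.2⟩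
  exfalso
  obtain ⟨f, u, v, hfu, huv, hfv⟩ := geometric_hahn_banach_compact_closed (hSx.linear_image Φ)
    (hSc.image Φ.continuous_of_finiteDimensional) hCx hCc hdisj
  let β : Fin n → ℝ := fun j => f (Pi.single j 1, 0)
  let γ : Fin n → ℝ := fun j => f (0, Pi.single j 1)
  have hf : ∀ x y, f (x, y) = ∑ j, (x j * β j + y j * γ j) := by
    intro x y
    have h1 : (x, y) = ∑ j, (x j • ((Pi.single j 1 : Fin n → ℝ), (0 : Fin n → ℝ)) +
        y j • ((0 : Fin n → ℝ), (Pi.single j 1 : Fin n → ℝ))) := by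
      ext j <;> simp [Prod.fst_sum, Prod.snd_sum, Finset.sum_apply, Pi.single_apply]
    conv_lhs => rw [h1]
    simp only [map_sum, map_add, map_smul, smul_eq_mul]
    rfl
  have hγ : ∀ j, γ j ≤ 0 := by
    intro j
    by_contra! hj
    -- Lowering coordinate `j` by `s` stays inside `C`; this `s` would bring the functional down to
    -- `v` or below.
    let s := max 0 ((f (p, fun j => p j * e j) - v) / γ j)
    have hs0 : 0 ≤ s := le_max_left _ _
    have hs1 : f (p, fun j => p j * e j) - v ≤ s * γ j :=
      (div_le_iff₀ hj).1 (le_max_right _ _)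
    have h1 := hfv (p, (fun j => p j * e j) - s • Pi.single j 1) ⟨rfl, fun i => by
      have : 0 ≤ s * (Pi.single j 1 : Fin n → ℝ) i :=
        mul_nonneg hs0 (by rw [Pi.single_apply]; split_ifs <;> norm_num)
      simpa using this⟩
    have h2 : ((p, (fun j => p j * e j) - s • Pi.single j 1) : (Fin n → ℝ) × (Fin n → ℝ)) =
        (p, fun j => p j * e j) - s • (0, Pi.single j 1) := by
      ext <;> simp
    rw [h2, map_sub, map_smul, smul_eq_mul] at h1
    change v < _ - s * γ j at h1
    linarith
  have hL : ∀ x : ℝ, Nonempty (Fin n) → ∃ l, ∀ l', β l' + γ l' * x ≤ β l + γ l * x :=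
    fun x _ => Finite.exists_max fun l => β l + γ l * x
  -- `L x i` is a cell maximizing `β l + γ l * x`. It does not depend on `i`, which only witnesses
  -- that there is a cell.
  have hL' : ∃ L : ℝ → Fin n → Fin n, ∀ x i l', β l' + γ l' * x ≤ β (L x i) + γ (L x i) * x ∧
      ∀ i', L x i = L x i' := by
    classical
    refine ⟨fun x i => (hL x ⟨i⟩).choose, fun x i l' => ⟨(hL x ⟨i⟩).choose_spec l', fun _ => rfl⟩⟩
  obtain ⟨L, hL⟩ := hL'
  -- The upper envelope of the lines `β l + γ l * x` is convex, so its slopes increase with `x`.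
  have hmono : Monotone fun j => γ (L (e j) j) := by
    intro i j hij
    rcases (he hij).eq_or_lt with h0 | h0
    · change γ (L (e i) i) ≤ γ (L (e j) j)
      rw [h0, (hL (e j) i i).2 j]
    · have h1 := (hL (e i) i (L (e j) j)).1
      have h2 := (hL (e j) j (L (e i) i)).1
      change γ (L (e i) i) ≤ γ (L (e j) j)
      by_contra! h3
      nlinarith
  -- Move all contents of cell `j` to the cell that the functional favours at level `e j`. By Abel
  -- summation this plan has a value at least that of `(p, p * e)`, contradicting the separation.
  let M : Fin n → Fin k → ℝ := fun l c => ∑ j, if L (e j) j = l then t j c else 0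
  have hM : M ∈ S := by
    refine ⟨fun l c => Finset.sum_nonneg fun j _ => ?_, fun c => ?_⟩
    · split_ifs
      exacts [ht j c, le_rfl]
    · change ∑ l, ∑ j, _ = _
      rw [Finset.sum_comm, ← htr c]
      exact Finset.sum_congr rfl fun j _ => by simp
  have h1 := hfu _ ⟨M, hM, rfl⟩
  have h2 := hfv (p, fun j => p j * e j) ⟨rfl, fun j => le_rfl⟩
  have hΦ : f (Φ M) = ∑ j, (p j * β (L (e j) j) + (∑ c, t j c * h c) * γ (L (e j) j)) := by
    change f (fun l => ∑ c, M l c, fun l => ∑ c, M l c * h c) = _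
    rw [hf]
    have h3 : ∀ l, (∑ c, M l c) * β l + (∑ c, M l c * h c) * γ l =
        ∑ j, if L (e j) j = l then p j * β l + (∑ c, t j c * h c) * γ l else 0 := by
      intro l
      have h4 : ∑ c, M l c = ∑ j, if L (e j) j = l then p j else 0 := by
        change ∑ c, ∑ j, _ = _
        rw [Finset.sum_comm]
        refine Finset.sum_congr rfl fun j _ => ?_
        split_ifs
        exacts [htp j, Finset.sum_const_zero]
      have h5 : ∑ c, M l c * h c = ∑ j, if L (e j) j = l then ∑ c, t j c * h c else 0 := by
        change ∑ c, (∑ j, _) * h c = _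
        simp only [Finset.sum_mul, ite_mul, zero_mul]
        rw [Finset.sum_comm]
        refine Finset.sum_congr rfl fun j _ => ?_
        split_ifs
        exacts [rfl, Finset.sum_const_zero]
      rw [h4, h5, Finset.sum_mul, Finset.sum_mul, ← Finset.sum_add_distrib]
      refine Finset.sum_congr rfl fun j _ => ?_
      split_ifs <;> simp
    simp only [h3]
    rw [Finset.sum_comm]
    exact Finset.sum_congr rfl fun j _ => by simp
  have hp : ∀ j, 0 ≤ p j := fun j => htp j ▸ Finset.sum_nonneg fun c _ => ht j c
  have h3 : f (p, fun j => p j * e j) ≤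
      ∑ j, (p j * β (L (e j) j) + p j * e j * γ (L (e j) j)) := by
    rw [hf]
    refine Finset.sum_le_sum fun j _ => ?_
    have := mul_le_mul_of_nonneg_left (hL (e j) j j).1 (hp j)
    linarith
  have h4 := mul_sum_le_sum_mul_of_partial_sums_nonpos (b := 0)
    (d := fun j => ∑ c, t j c * h c - p j * e j) hmono (fun j => hγ _) (fun l hl => by
      rw [Finset.sum_sub_distrib]
      linarith [hpart l hl])
  rw [zero_mul] at h4
  have h5 : ∑ j, γ (L (e j) j) * (∑ c, t j c * h c - p j * e j) = f (Φ M) -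
      ∑ j, (p j * β (L (e j) j) + p j * e j * γ (L (e j) j)) := by
    rw [hΦ, ← Finset.sum_sub_distrib]
    exact Finset.sum_congr rfl fun j _ => by ring
  linarith
end

/-! ### Choice of breakpoints -/

noncomputable section

/-- A set of at most `n + 1` breakpoints can be modified, using the knots `S 1, …, S (m + 1)`, into a
set of `n + 1` breakpoints that contains at most the two end points of each piece `[S l, S (l + 1)]`
unless it meets that piece in a single point. -/
theorem exists_breakpoints {m n : ℕ} (hmn : n < m) {S : ℕ → ℝ} (hS0 : S 1 = 0)
    (hS1 : S (m + 1) = 1) (hSm : Monotone S) (hS : ∀ l, 1 ≤ l → l ≤ m → S l < S (l + 1))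
    {V : Finset ℝ} (hVc : V.card ≤ n + 1) (hV0 : (0 : ℝ) ∈ V) (hV1 : (1 : ℝ) ∈ V)
    (hV : ∀ x ∈ V, x ∈ Set.Icc (0 : ℝ) 1) :
    ∃ B : Finset ℝ, B.card = n + 1 ∧ (0 : ℝ) ∈ B ∧ (1 : ℝ) ∈ B ∧ (∀ x ∈ B, x ∈ Set.Icc (0 : ℝ) 1) ∧
      (∀ v ∈ V, v ∈ B ∨ ∃ l, 1 ≤ l ∧ l ≤ m ∧ S l ∈ B ∧ S (l + 1) ∈ B ∧ v ∈ Set.Icc (S l) (S (l + 1))) ∧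
      ∀ l, 1 ≤ l → l ≤ m → ∀ x ∈ B, ∀ y ∈ B, S l ≤ x → x < y → y ≤ S (l + 1) →
        x = S l ∧ y = S (l + 1) := by
  classical
  let N : Finset ℝ := (Finset.Icc 1 (m + 1)).image S
  have hlt : ∀ i j, 1 ≤ i → i < j → j ≤ m + 1 → S i < S j := fun i j hi hij hj =>
    (hS i hi (by omega)).trans_le (hSm hij)
  have hNc : N.card = m + 1 := by
    rw [Finset.card_image_of_injOn, Nat.card_Icc, Nat.add_sub_cancel]
    intro i hi j hj hij
    simp only [Finset.coe_Icc, Set.mem_Icc] at hi hj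
    rcases lt_trichotomy i j with h | h | h
    · exact absurd hij (hlt i j hi.1 h hj.2).ne
    · exact h
    · exact absurd hij (hlt j i hj.1 h hi.2).ne'
  have hN01 : ∀ x ∈ N, x ∈ Set.Icc (0 : ℝ) 1 := by
    intro x hx
    obtain ⟨l, hl, rfl⟩ := Finset.mem_image.1 hx
    rw [Finset.mem_Icc] at hl
    exact ⟨hS0 ▸ hSm hl.1, hS1 ▸ hSm hl.2⟩
  let G : Finset ℝ → Prop := fun B => B.card ≤ n + 1 ∧ (0 : ℝ) ∈ B ∧ (1 : ℝ) ∈ B ∧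
    (∀ x ∈ B, x ∈ Set.Icc (0 : ℝ) 1) ∧
    (∀ v ∈ V, v ∈ B ∨ ∃ l, 1 ≤ l ∧ l ≤ m ∧ S l ∈ B ∧ S (l + 1) ∈ B ∧ v ∈ Set.Icc (S l) (S (l + 1)))
  -- Among the admissible sets, take one with the most knots.
  obtain ⟨B, hB, hmax⟩ : ∃ B, G B ∧ ∀ B', G B' → (B' ∩ N).card ≤ (B ∩ N).card := by
    let A : Set ℕ := {k | ∃ B, G B ∧ (B ∩ N).card = k}
    have hne : A.Nonempty := ⟨_, V, ⟨hVc, hV0, hV1, hV, fun v hv => Or.inl hv⟩, rfl⟩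
    have hbdd : BddAbove A := ⟨m + 1, by
      rintro k ⟨B, -, rfl⟩
      exact hNc ▸ Finset.card_le_card Finset.inter_subset_right⟩
    obtain ⟨B, hB, hk⟩ := Nat.sSup_mem hne hbdd
    exact ⟨B, hB, fun B' hB' => hk ▸ le_csSup hbdd ⟨B', hB', rfl⟩⟩
  -- A maximizer with at most `n` points would miss one of the `m + 1` knots, and that knot could be
  -- added.
  have hcard : ∀ B, G B → (∀ B', G B' → (B' ∩ N).card ≤ (B ∩ N).card) → B.card = n + 1 := by
    rintro B ⟨hBc, hB0, hB1, hB, hBV⟩ hmax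
    by_contra hne
    obtain ⟨x, hxN, hxB⟩ : ∃ x ∈ N, x ∉ B := by
      by_contra! hsub
      have := Finset.card_le_card (show N ⊆ B from hsub)
      omega
    have hG : G (insert x B) := by
      refine ⟨?_, Finset.mem_insert_of_mem hB0, Finset.mem_insert_of_mem hB1, ?_, ?_⟩
      · rw [Finset.card_insert_of_notMem hxB]
        omega
      · intro y hy
        rcases Finset.mem_insert.1 hy with rfl | hy
        exacts [hN01 _ hxN, hB y hy]
      · intro v hv
        rcases hBV v hv with h | ⟨l, hl, hl', h1, h2, h3⟩
        · exact Or.inl (Finset.mem_insert_of_mem h)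
        · exact Or.inr ⟨l, hl, hl', Finset.mem_insert_of_mem h1, Finset.mem_insert_of_mem h2, h3⟩
    have := hmax _ hG
    rw [Finset.insert_inter_of_mem hxN, Finset.card_insert_of_notMem (by simp [hxB])] at this
    omega
  refine ⟨B, hcard B hB hmax, hB.2.1, hB.2.2.1, hB.2.2.2.1, hB.2.2.2.2, ?_⟩
  intro l hl hlm x hx y hy hlx hxy hyl
  have hll := hS l hl hlm
  -- Exchange the points of `B` in the piece for its two ends: at least two points leave, two enter,
  -- and no knot is lost.
  let X := B.filter (· ∈ Set.Icc (S l) (S (l + 1)))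
  let Y := B.filter (· ∉ Set.Icc (S l) (S (l + 1)))
  have hXY : X.card + Y.card = B.card := Finset.card_filter_add_card_filter_not _
  have hxX : x ∈ X := Finset.mem_filter.2 ⟨hx, hlx, hxy.le.trans hyl⟩
  have hyX : y ∈ X := Finset.mem_filter.2 ⟨hy, hlx.trans hxy.le, hyl⟩
  have hX2 : 2 ≤ X.card := by
    rw [← Finset.card_pair hxy.ne]
    exact Finset.card_le_card (by simp [Finset.insert_subset_iff, hxX, hyX])
  let E : Finset ℝ := {S l, S (l + 1)}
  have hE2 : E.card = 2 := Finset.card_pair hll.ne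
  have haN : S l ∈ N := Finset.mem_image.2 ⟨l, Finset.mem_Icc.2 ⟨hl, by omega⟩, rfl⟩
  have hbN : S (l + 1) ∈ N :=
    Finset.mem_image.2 ⟨l + 1, Finset.mem_Icc.2 ⟨by omega, by omega⟩, rfl⟩
  have hEN : E ⊆ N := by simp [E, Finset.insert_subset_iff, haN, hbN]
  have hXN : X ∩ N ⊆ E := by
    intro z hz
    obtain ⟨hzX, hzN⟩ := Finset.mem_inter.1 hz
    obtain ⟨i, hi, rfl⟩ := Finset.mem_image.1 hzN
    have hz' := (Finset.mem_filter.1 hzX).2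
    rw [Finset.mem_Icc] at hi
    have h1 : l ≤ i := by
      by_contra! h
      exact absurd hz'.1 (not_le.2 (hlt i l hi.1 h (by omega)))
    have h2 : i ≤ l + 1 := by
      by_contra! h
      exact absurd hz'.2 (not_le.2 (hlt (l + 1) i (by omega) h hi.2))
    obtain rfl | rfl : i = l ∨ i = l + 1 := by omega
    · simp [E]
    · simp [E]
  have hYE : Disjoint Y E := by
    rw [Finset.disjoint_left]
    intro z hz hz'
    refine (Finset.mem_filter.1 hz).2 ?_
    rcases Finset.mem_insert.1 hz' with rfl | hz'
    · exact ⟨le_rfl, hll.le⟩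
    · rw [Finset.mem_singleton.1 hz']
      exact ⟨hll.le, le_rfl⟩
  have hYEc : (Y ∪ E).card = Y.card + 2 := by rw [Finset.card_union_of_disjoint hYE, hE2]
  have hBYE : ∀ z ∈ B, z ∈ Y ∪ E ∨ z ∈ Set.Icc (S l) (S (l + 1)) := fun z hz =>
    or_iff_not_imp_right.2 fun h => Finset.mem_union_left _ (Finset.mem_filter.2 ⟨hz, h⟩)
  have hNYE : ∀ z ∈ B, z ∈ N → z ∈ Y ∪ E := fun z hz hzN => by
    by_cases h : z ∈ Set.Icc (S l) (S (l + 1))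
    · exact Finset.mem_union_right _
        (hXN (Finset.mem_inter.2 ⟨Finset.mem_filter.2 ⟨hz, h⟩, hzN⟩))
    · exact Finset.mem_union_left _ (Finset.mem_filter.2 ⟨hz, h⟩)
  have hmemN : ∀ i, 1 ≤ i → i ≤ m + 1 → S i ∈ N := fun i hi hi' =>
    Finset.mem_image.2 ⟨i, Finset.mem_Icc.2 ⟨hi, hi'⟩, rfl⟩
  have hG : G (Y ∪ E) := by
    obtain ⟨hBc, hB0, hB1, hB, hBV⟩ := hB
    refine ⟨by omega, hNYE 0 hB0 (hS0 ▸ hmemN 1 le_rfl (by omega)),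
      hNYE 1 hB1 (hS1 ▸ hmemN (m + 1) (by omega) le_rfl), ?_, ?_⟩
    · intro z hz
      rcases Finset.mem_union.1 hz with hz | hz
      exacts [hB z (Finset.mem_filter.1 hz).1, hN01 z (hEN hz)]
    · intro v hv
      rcases hBV v hv with h | ⟨i, hi, hi', h1, h2, h3⟩
      · rcases hBYE v h with h | h
        · exact Or.inl h
        · exact Or.inr ⟨l, hl, hlm, Finset.mem_union_right _ (by simp [E]),
            Finset.mem_union_right _ (by simp [E]), h⟩
      · exact Or.inr ⟨i, hi, hi', hNYE _ h1 (hmemN i hi (by omega)),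
          hNYE _ h2 (hmemN (i + 1) (by omega) (by omega)), h3⟩
  have hsub : B ∩ N ⊆ (Y ∪ E) ∩ N := fun z hz => by
    rw [Finset.mem_inter] at hz ⊢
    exact ⟨hNYE z hz.1 hz.2, hz.2⟩
  -- By maximality no knot is gained either, so both ends were already in `B`. As both sets have `n
  -- + 1` points, `B` has no other point in the piece.
  have hYEmax : ∀ B', G B' → (B' ∩ N).card ≤ ((Y ∪ E) ∩ N).card := fun B' hB' =>
    (hmax B' hB').trans (Finset.card_le_card hsub)
  have hc1 := hcard _ hG hYEmax
  have hc2 := hcard B hB hmax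
  have heq : B ∩ N = (Y ∪ E) ∩ N := Finset.eq_of_subset_of_card_le hsub (hmax _ hG)
  have hEX : E ⊆ X := by
    intro z hz
    refine Finset.mem_filter.2 ⟨?_, ?_⟩
    · have : z ∈ B ∩ N := heq ▸ Finset.mem_inter.2 ⟨Finset.mem_union_right _ hz, hEN hz⟩
      exact (Finset.mem_inter.1 this).1
    · by_contra h
      rcases Finset.mem_insert.1 hz with rfl | hz'
      · exact h ⟨le_rfl, hll.le⟩
      · rw [Finset.mem_singleton.1 hz'] at h
        exact h ⟨hll.le, le_rfl⟩
  have hEX' : E = X := Finset.eq_of_subset_of_card_le hEX (by omega)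
  rw [← hEX'] at hxX hyX
  simp only [E, Finset.mem_insert, Finset.mem_singleton] at hxX hyX
  rcases hxX with rfl | rfl <;> rcases hyX with rfl | rfl
  · exact absurd hxy (lt_irrefl _)
  · exact ⟨rfl, rfl⟩
  · exact absurd hxy (not_lt.2 hll.le)
  · exact absurd hxy (lt_irrefl _)

/-- The increasing enumeration `u 0 < ⋯ < u n` of a finite set. -/
theorem exists_enumeration {n : ℕ} {B : Finset ℝ} (hc : B.card = n + 1) (h0 : (0 : ℝ) ∈ B)
    (h1 : (1 : ℝ) ∈ B) (hB : ∀ x ∈ B, x ∈ Set.Icc (0 : ℝ) 1) :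
    ∃ u : ℕ → ℝ, u 0 = 0 ∧ u n = 1 ∧ Monotone u ∧ (∀ c < n, u c < u (c + 1)) ∧
      (∀ c ≤ n, u c ∈ B) ∧ ∀ x ∈ B, ∃ c ≤ n, u c = x := by
  let g := B.orderEmbOfFin hc
  -- Truncating the index at `n` keeps `u` monotone on all of `ℕ`.
  let u : ℕ → ℝ := fun c => g ⟨min c n, by omega⟩
  have hu : ∀ c (h : c < n + 1), u c = g ⟨c, h⟩ := fun c h => by
    change g _ = g _
    congr 2
    omega
  have hmem : ∀ c, u c ∈ B := fun c => Finset.orderEmbOfFin_mem B hc _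
  have hmono : Monotone u := fun a b hab => g.monotone (by
    rw [Fin.mk_le_mk]; omega)
  have hsurj : ∀ x ∈ B, ∃ c ≤ n, u c = x := by
    intro x hx
    have : x ∈ Set.range g := by
      rw [Finset.range_orderEmbOfFin]
      exact hx
    obtain ⟨c, rfl⟩ := this
    exact ⟨c, by omega, hu c c.2⟩
  refine ⟨u, ?_, ?_, hmono, ?_, fun c _ => hmem c, hsurj⟩
  · obtain ⟨c, -, hc⟩ := hsurj 0 h0
    exact le_antisymm (hc ▸ hmono (Nat.zero_le c)) (hB _ (hmem 0)).1
  · obtain ⟨c, hcn, hc⟩ := hsurj 1 h1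
    exact le_antisymm (hB _ (hmem n)).2 (hc ▸ hmono hcn)
  · intro c hcn
    rw [hu c (by omega), hu (c + 1) (by omega)]
    exact g.strictMono (by rw [Fin.mk_lt_mk]; omega)

/-- The length of the part of the interval `[S l, S (l + 1)]` below `x`. -/
def overlap (S : ℕ → ℝ) (x : ℝ) (l : ℕ) : ℝ := min x (S (l + 1)) - min x (S l)

theorem sum_overlap (S : ℕ → ℝ) (x : ℝ) (k : ℕ) :
    ∑ l ∈ Finset.range k, overlap S x l = min x (S k) - min x (S 0) :=
  Finset.sum_range_sub (fun l => min x (S l)) k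

theorem overlap_mono {S : ℕ → ℝ} (hS : Monotone S) {x y : ℝ} (hxy : x ≤ y) (l : ℕ) :
    overlap S x l ≤ overlap S y l := by
  have := hS (Nat.le_succ l)
  simp only [overlap, Nat.succ_eq_add_one] at this ⊢
  rcases le_total x (S (l + 1)) with h1 | h1 <;> rcases le_total x (S l) with h2 | h2 <;>
    rcases le_total y (S (l + 1)) with h3 | h3 <;> rcases le_total y (S l) with h4 | h4 <;>
    simp only [min_eq_left, min_eq_right, h1, h2, h3, h4] <;> linarith

theorem overlap_of_le {S : ℕ → ℝ} (hS : Monotone S) {x : ℝ} {l : ℕ} (h : x ≤ S l) :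
    overlap S x l = 0 := by
  rw [overlap, min_eq_left h, min_eq_left (h.trans (hS (Nat.le_succ l))), sub_self]

theorem overlap_of_ge {S : ℕ → ℝ} (hS : Monotone S) {x : ℝ} {l : ℕ} (h : S (l + 1) ≤ x) :
    overlap S x l = S (l + 1) - S l := by
  rw [overlap, min_eq_right h, min_eq_right ((hS (Nat.le_succ l)).trans h)]

theorem overlap_of_mem {S : ℕ → ℝ} {x : ℝ} {l : ℕ} (h1 : S l ≤ x) (h2 : x ≤ S (l + 1)) :
    overlap S x l = x - S l := by
  rw [overlap, min_eq_left h2, min_eq_right h1]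
end

/-! ### The Lorenz curve of a mixture -/

noncomputable section
namespace BIDMC

theorem labelled_succ {m : ℕ} (f : Fin m → ℝ) (i : Fin m) : labelled f (i + 1) = f i := by
  rw [labelled, dif_pos ⟨by omega, by omega⟩]
  rfl

theorem labelled_of_lt {m : ℕ} (f : Fin m → ℝ) {l : ℕ} (h : m < l) : labelled f l = 0 :=
  dif_neg (by omega)

theorem labelled_zero {m : ℕ} (f : Fin m → ℝ) : labelled f 0 = 0 := dif_neg (by omega)

theorem exists_eq_succ {m l : ℕ} (h1 : 1 ≤ l) (h2 : l ≤ m) : ∃ i : Fin m, l = i + 1 :=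
  ⟨⟨l - 1, by omega⟩, by simp only []; omega⟩

theorem sum_range_add_two {m : ℕ} {g : ℕ → ℝ} (h0 : g 0 = 0) (h1 : g (m + 1) = 0) :
    ∑ l ∈ Finset.range (m + 2), g l = ∑ i : Fin m, g (i + 1) := by
  rw [Finset.sum_range_succ, h1, add_zero, Finset.sum_range_succ', h0, add_zero,
    Fin.sum_univ_eq_sum_range fun i => g (i + 1)]

/-- The knots of the cumulative weights: `cum q l` is the total weight of the labels below `l`. -/
def cum {m : ℕ} (q : Fin m → ℝ) (l : ℕ) : ℝ := ∑ i ∈ Finset.range l, labelled q i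

/-- The error mass of the best particles of total weight `x` of `∑ i, q i • B(σ i)`. -/
def lorenz {m : ℕ} (q σ : Fin m → ℝ) (x : ℝ) : ℝ :=
  ∑ l ∈ Finset.range (m + 2), labelled σ l * overlap (cum q) x l

section

variable {m : ℕ} {q σ : Fin m → ℝ}

theorem cum_zero : cum q 0 = 0 := rfl

theorem cum_succ (l : ℕ) : cum q (l + 1) = cum q l + labelled q l := Finset.sum_range_succ _ _

theorem cum_one : cum q 1 = 0 := by rw [cum_succ, cum_zero, labelled_zero, add_zero]

theorem labelled_nonneg (hq : ∀ i, 0 < q i) (l : ℕ) : 0 ≤ labelled q l := by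
  unfold labelled
  split_ifs
  exacts [(hq _).le, le_rfl]

theorem cum_mono (hq : ∀ i, 0 < q i) : Monotone (cum q) :=
  monotone_nat_of_le_succ fun l => by
    rw [cum_succ]
    linarith [labelled_nonneg hq l]

theorem cum_last : cum q (m + 2) = ∑ i, q i := by
  rw [cum, sum_range_add_two (labelled_zero q) (labelled_of_lt q (Nat.lt_succ_self m))]
  simp only [labelled_succ]

theorem cum_add_one : cum q (m + 1) = ∑ i, q i := by
  rw [← cum_last, cum_succ (m + 1), labelled_of_lt q (Nat.lt_succ_self m), add_zero]

theorem cum_lt (hq : ∀ i, 0 < q i) {l : ℕ} (h1 : 1 ≤ l) (h2 : l ≤ m) :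
    cum q l < cum q (l + 1) := by
  obtain ⟨i, rfl⟩ := exists_eq_succ h1 h2
  rw [cum_succ (i + 1), labelled_succ]
  linarith [hq i]

theorem labelled_le (hσ : StrictMono σ) {k l : ℕ} (hk : 1 ≤ k) (hkl : k ≤ l) (hl : l ≤ m) :
    labelled σ k ≤ labelled σ l := by
  obtain ⟨i, rfl⟩ := exists_eq_succ hk (hkl.trans hl)
  obtain ⟨j, rfl⟩ := exists_eq_succ (hk.trans hkl) hl
  rw [labelled_succ, labelled_succ]
  exact hσ.monotone (by rw [Fin.le_def]; omega)

theorem labelled_lt (hσ : StrictMono σ) {k l : ℕ} (hk : 1 ≤ k) (hkl : k < l) (hl : l ≤ m) :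
    labelled σ k < labelled σ l := by
  obtain ⟨i, rfl⟩ := exists_eq_succ hk (hkl.le.trans hl)
  obtain ⟨j, rfl⟩ := exists_eq_succ (hk.trans hkl.le) hl
  rw [labelled_succ, labelled_succ]
  exact hσ (by rw [Fin.lt_def]; omega)

/-- Only the labels `1, …, m` have pieces of positive length; the boundary labels `0` and `m + 1`
are dummies. -/
theorem overlap_cum_eq_zero (x : ℝ) {l : ℕ} (hl : l = 0 ∨ m < l) : overlap (cum q) x l = 0 := by
  have : labelled q l = 0 := by
    rcases hl with rfl | hl
    exacts [labelled_zero q, labelled_of_lt q hl]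
  rw [overlap, cum_succ, this, add_zero, sub_self]

theorem sum_overlap_cum (hs : ∑ i, q i = 1) {x : ℝ} (hx : x ∈ Set.Icc (0 : ℝ) 1) :
    ∑ l ∈ Finset.range (m + 2), overlap (cum q) x l = x := by
  rw [sum_overlap, cum_last, hs, cum_zero, min_eq_left hx.2, min_eq_right hx.1, sub_zero]

theorem lorenz_sub (x y : ℝ) : lorenz q σ y - lorenz q σ x =
    ∑ l ∈ Finset.range (m + 2), labelled σ l * (overlap (cum q) y l - overlap (cum q) x l) := by
  simp only [lorenz, mul_sub, Finset.sum_sub_distrib]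

/-- Compares the curve with a line of slope `σ k`; the sign of each term on the right is then
visible. -/
theorem mul_sub_lorenz (hs : ∑ i, q i = 1) {x y : ℝ} (hx : x ∈ Set.Icc (0 : ℝ) 1)
    (hy : y ∈ Set.Icc (0 : ℝ) 1) (k : ℕ) :
    labelled σ k * (y - x) - (lorenz q σ y - lorenz q σ x) = ∑ l ∈ Finset.range (m + 2),
      (labelled σ k - labelled σ l) * (overlap (cum q) y l - overlap (cum q) x l) := by
  have h1 : y - x =
      ∑ l ∈ Finset.range (m + 2), (overlap (cum q) y l - overlap (cum q) x l) := by
    rw [Finset.sum_sub_distrib, sum_overlap_cum hs hx, sum_overlap_cum hs hy]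
  simp only [sub_mul (labelled σ k), Finset.sum_sub_distrib (f := fun l => labelled σ k * _),
    ← Finset.mul_sum]
  rw [← h1, lorenz_sub]

/-- To the left of the right end of piece `k` all slopes are at most `σ k`, and those of earlier
pieces are strictly smaller. Equality therefore keeps the interval off the earlier pieces. -/
theorem lorenz_sub_le (hq : ∀ i, 0 < q i) (hs : ∑ i, q i = 1) (hσ : StrictMono σ) {x y : ℝ}
    (hx : 0 ≤ x) (hxy : x < y) (hy : y ≤ 1) {k : ℕ} (hkm : k ≤ m)
    (hyk : y ≤ cum q (k + 1)) :
    lorenz q σ y - lorenz q σ x ≤ labelled σ k * (y - x) ∧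
      (lorenz q σ y - lorenz q σ x = labelled σ k * (y - x) → cum q k ≤ x) := by
  have hS := cum_mono hq
  have key := mul_sub_lorenz (q := q) (σ := σ) hs (x := x) (y := y) ⟨hx, hxy.le.trans hy⟩
    ⟨hx.trans hxy.le, hy⟩ k
  have hnn : ∀ l ∈ Finset.range (m + 2), 0 ≤ (labelled σ k - labelled σ l) *
      (overlap (cum q) y l - overlap (cum q) x l) := by
    intro l hl
    rw [Finset.mem_range] at hl
    by_cases h0 : l = 0 ∨ m < l
    · rw [overlap_cum_eq_zero _ h0, overlap_cum_eq_zero _ h0, sub_zero, mul_zero]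
    rcases le_or_gt l k with h | h
    · exact mul_nonneg (sub_nonneg.2 (labelled_le hσ (by omega) h hkm))
        (sub_nonneg.2 (overlap_mono hS hxy.le l))
    · have h1 : y ≤ cum q l := hyk.trans (hS h)
      rw [overlap_of_le hS h1, overlap_of_le hS (hxy.le.trans h1), sub_zero, mul_zero]
  refine ⟨?_, fun heq => ?_⟩
  · linarith [Finset.sum_nonneg hnn]
  · rw [heq, sub_self, eq_comm, Finset.sum_eq_zero_iff_of_nonneg hnn] at key
    have hz : ∀ l ∈ Finset.range k, overlap (cum q) y l - overlap (cum q) x l = 0 := by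
      intro l hl
      rw [Finset.mem_range] at hl
      rcases Nat.eq_zero_or_pos l with h | h
      · rw [overlap_cum_eq_zero _ (Or.inl h), overlap_cum_eq_zero _ (Or.inl h), sub_zero]
      · have h1 := key l (Finset.mem_range.2 (by omega))
        exact (mul_eq_zero.1 h1).resolve_left (sub_pos.2 (labelled_lt hσ h hl hkm)).ne'
    have hsum := Finset.sum_eq_zero hz
    rw [Finset.sum_sub_distrib, sum_overlap, sum_overlap, cum_zero, min_eq_right hx,
      min_eq_right (hx.trans hxy.le)] at hsum
    by_contra! hlt
    rw [min_eq_left hlt.le] at hsum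
    have := lt_min hxy hlt
    linarith

theorem le_lorenz_sub (hq : ∀ i, 0 < q i) (hs : ∑ i, q i = 1) (hσ : StrictMono σ) {x y : ℝ}
    (hx : 0 ≤ x) (hxy : x < y) (hy : y ≤ 1) {k : ℕ} (hk : 1 ≤ k) (hkm : k ≤ m)
    (hxk : cum q k ≤ x) :
    labelled σ k * (y - x) ≤ lorenz q σ y - lorenz q σ x ∧
      (lorenz q σ y - lorenz q σ x = labelled σ k * (y - x) → y ≤ cum q (k + 1)) := by
  have hS := cum_mono hq
  have key := mul_sub_lorenz (q := q) (σ := σ) hs (x := x) (y := y) ⟨hx, hxy.le.trans hy⟩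
    ⟨hx.trans hxy.le, hy⟩ k
  have hnn : ∀ l ∈ Finset.range (m + 2), (labelled σ k - labelled σ l) *
      (overlap (cum q) y l - overlap (cum q) x l) ≤ 0 := by
    intro l hl
    rw [Finset.mem_range] at hl
    by_cases h0 : l = 0 ∨ m < l
    · rw [overlap_cum_eq_zero _ h0, overlap_cum_eq_zero _ h0, sub_zero, mul_zero]
    rcases le_or_gt k l with h | h
    · exact mul_nonpos_of_nonpos_of_nonneg (sub_nonpos.2 (labelled_le hσ hk h (by omega)))
        (sub_nonneg.2 (overlap_mono hS hxy.le l))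
    · have h1 : cum q (l + 1) ≤ x := (hS h).trans hxk
      rw [overlap_of_ge hS h1, overlap_of_ge hS (h1.trans hxy.le), sub_self, mul_zero]
  refine ⟨?_, fun heq => ?_⟩
  · linarith [Finset.sum_nonpos hnn]
  · rw [heq, sub_self, eq_comm, Finset.sum_eq_zero_iff_of_nonpos hnn] at key
    have hz : ∀ l ∈ Finset.range (m + 2), l ∉ Finset.range (k + 1) →
        overlap (cum q) y l - overlap (cum q) x l = 0 := by
      intro l hl hlk
      rw [Finset.mem_range] at hl hlk
      by_cases h : m < l
      · rw [overlap_cum_eq_zero _ (Or.inr h), overlap_cum_eq_zero _ (Or.inr h), sub_zero]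
      · have h1 := key l (Finset.mem_range.2 hl)
        exact (mul_eq_zero.1 h1).resolve_left
          (sub_neg.2 (labelled_lt hσ hk (by omega) (by omega))).ne
    have hsum := Finset.sum_subset (Finset.range_mono (by omega : k + 1 ≤ m + 2)) hz
    rw [Finset.sum_sub_distrib, Finset.sum_sub_distrib,
      sum_overlap_cum hs ⟨hx, hxy.le.trans hy⟩, sum_overlap_cum hs ⟨hx.trans hxy.le, hy⟩,
      sum_overlap, sum_overlap, cum_zero, min_eq_right hx, min_eq_right (hx.trans hxy.le)] at hsum
    by_contra! hlt
    rw [min_eq_right hlt.le] at hsum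
    rcases le_total x (cum q (k + 1)) with h | h
    · rw [min_eq_left h] at hsum
      linarith
    · rw [min_eq_right h] at hsum
      linarith

theorem lorenz_sub_eq (hq : ∀ i, 0 < q i) (hs : ∑ i, q i = 1) (hσ : StrictMono σ) {x y : ℝ}
    (hx : 0 ≤ x) (hxy : x ≤ y) (hy : y ≤ 1) {k : ℕ} (hk : 1 ≤ k) (hkm : k ≤ m)
    (hxk : cum q k ≤ x) (hyk : y ≤ cum q (k + 1)) :
    lorenz q σ y - lorenz q σ x = labelled σ k * (y - x) := by
  rcases hxy.eq_or_lt with rfl | hxy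
  · simp
  · exact le_antisymm (lorenz_sub_le hq hs hσ hx hxy hy hkm hyk).1
      (le_lorenz_sub hq hs hσ hx hxy hy hk hkm hxk).1

theorem lorenz_zero (hq : ∀ i, 0 < q i) : lorenz q σ 0 = 0 :=
  Finset.sum_eq_zero fun l _ => by
    rw [overlap_of_le (cum_mono hq) (cum_zero (q := q) ▸ cum_mono hq (Nat.zero_le l)), mul_zero]

theorem exists_cum_le (hs : ∑ i, q i = 1) {x : ℝ} (hm : 1 ≤ m) (hx : x ∈ Set.Icc (0 : ℝ) 1) :
    ∃ k, 1 ≤ k ∧ k ≤ m ∧ cum q k ≤ x ∧ x ≤ cum q (k + 1) := by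
  by_contra! h
  have : ∀ k, 1 ≤ k → k ≤ m + 1 → cum q k ≤ x := by
    intro k hk
    induction k, hk using Nat.le_induction with
    | base => exact fun _ => cum_one.trans_le hx.1
    | succ k hk ih => exact fun hkm => (h k hk (by omega) (ih (by omega))).le
  have h1 := this m hm (by omega)
  have h2 := h m hm le_rfl h1
  rw [cum_add_one, hs] at h2
  exact absurd hx.2 (not_le.2 h2)

/-- Exchange argument: with `j` the label whose piece contains `x`, the greedy portion takes
everything cheaper than `σ j` and nothing dearer. Any other portion of the same weight deviates in
the costly direction at each label. -/
theorem lorenz_le_sum (hq : ∀ i, 0 < q i) (hs : ∑ i, q i = 1) (hσ : StrictMono σ) {x : ℝ}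
    (hx : x ∈ Set.Icc (0 : ℝ) 1) {τ : Fin m → ℝ} (hτ : ∀ i, τ i ∈ Set.Icc 0 (q i))
    (hτx : ∑ i, τ i = x) : lorenz q σ x ≤ ∑ i, σ i * τ i := by
  have hm : 1 ≤ m := by
    by_contra! h
    obtain rfl : m = 0 := by omega
    simp at hs
  obtain ⟨k, hk, hkm, h1, h2⟩ := exists_cum_le hs hm hx
  obtain ⟨j, rfl⟩ := exists_eq_succ hk hkm
  have hS := cum_mono hq
  have hsum := sum_overlap_cum hs hx
  rw [sum_range_add_two (overlap_cum_eq_zero x (Or.inl rfl))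
    (overlap_cum_eq_zero x (Or.inr (Nat.lt_succ_self m)))] at hsum
  have hF : lorenz q σ x = ∑ i : Fin m, σ i * overlap (cum q) x (i + 1) := by
    rw [lorenz, sum_range_add_two]
    · simp only [labelled_succ]
    · rw [labelled_zero, zero_mul]
    · rw [labelled_of_lt σ (Nat.lt_succ_self m), zero_mul]
  have hterm : ∀ i : Fin m, 0 ≤ (σ i - σ j) * (τ i - overlap (cum q) x (i + 1)) := by
    intro i
    rcases lt_trichotomy i j with h | rfl | h
    · rw [overlap_of_ge hS ((hS (by omega : (i : ℕ) + 1 + 1 ≤ j + 1)).trans h1), cum_succ (i + 1),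
        labelled_succ]
      refine mul_nonneg_of_nonpos_of_nonpos (sub_nonpos.2 (hσ h).le) ?_
      linarith [(hτ i).2]
    · simp
    · rw [overlap_of_le hS (h2.trans (hS (by omega : (j : ℕ) + 1 + 1 ≤ i + 1))), sub_zero]
      exact mul_nonneg (sub_nonneg.2 (hσ h).le) (hτ i).1
  have h3 : ∑ i : Fin m, (σ i - σ j) * (τ i - overlap (cum q) x (i + 1)) =
      (∑ i, σ i * τ i - ∑ i : Fin m, σ i * overlap (cum q) x (i + 1)) -
        σ j * (∑ i, τ i - ∑ i : Fin m, overlap (cum q) x (i + 1)) := by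
    simp only [Finset.mul_sum, ← Finset.sum_sub_distrib]
    exact Finset.sum_congr rfl fun i _ => by ring
  rw [hsum, hτx, sub_self, mul_zero, sub_zero] at h3
  rw [hF]
  linarith [Finset.sum_nonneg fun i (_ : i ∈ Finset.univ) => hterm i]

/-- Identifies the segment weights with the parts of the pieces lying between two cuts. -/
theorem segment_eq_overlap_sub (hq : ∀ i, 0 < q i) {a b : ℕ} (hab : a < b) {x y : ℝ}
    (hxa : cum q a ≤ x) (hxa' : x ≤ cum q (a + 1)) (hyb : cum q b ≤ y) (hyb' : y ≤ cum q (b + 1))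
    (l : ℕ) :
    segment q a b (cum q (a + 1) - x) (cum q (b + 1) - y) l =
      overlap (cum q) y l - overlap (cum q) x l := by
  have hS := cum_mono hq
  have hxb : x ≤ cum q b := hxa'.trans (hS hab)
  unfold segment
  split_ifs with h1 h2 h3
  · subst h1
    rw [overlap_of_mem hxa hxa', overlap_of_ge hS ((hS hab).trans hyb)]
    ring
  · subst h2
    rw [overlap_of_mem hyb hyb', overlap_of_le hS hxb, cum_succ]
    ring
  · rw [overlap_of_le hS (hxa'.trans (hS h3.1)), overlap_of_ge hS ((hS h3.2).trans hyb), cum_succ]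
    ring
  · rcases lt_or_gt_of_ne h1 with h | h
    · have h4 : cum q (l + 1) ≤ x := (hS h).trans hxa
      rw [overlap_of_ge hS h4, overlap_of_ge hS (h4.trans (hxb.trans hyb)), sub_self]
    · have h5 : b < l := by omega
      have h4 : y ≤ cum q l := hyb'.trans (hS h5)
      rw [overlap_of_le hS h4, overlap_of_le hS ((hxb.trans hyb).trans h4), sub_self]

end

end BIDMC
end

/-! ### Cells, chords and the merged channel -/

noncomputable section
namespace BIDMC

/-- `0 = u 0 < ⋯ < u n = 1` cut the cumulative weights of `q` into `n` cells, such that a cell inside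
the piece of a single label is the whole piece. -/
structure IsBreakpoints {m : ℕ} (q : Fin m → ℝ) (n : ℕ) (u : ℕ → ℝ) : Prop where
  zero : u 0 = 0
  last : u n = 1
  mono : Monotone u
  lt_succ : ∀ c < n, u c < u (c + 1)
  piece : ∀ l, 1 ≤ l → l ≤ m → ∀ c ≤ n, ∀ c' ≤ n, cum q l ≤ u c → u c < u c' →
    u c' ≤ cum q (l + 1) → u c = cum q l ∧ u c' = cum q (l + 1)

/-- The slope of the chord of the function `F` over the `c`-th cell. -/
def chord (F : ℝ → ℝ) (u : ℕ → ℝ) (c : ℕ) : ℝ := (F (u (c + 1)) - F (u c)) / (u (c + 1) - u c)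

section

variable {m n : ℕ} {q σ : Fin m → ℝ} {u : ℕ → ℝ}

theorem IsBreakpoints.mem (h : IsBreakpoints q n u) {c : ℕ} (hc : c ≤ n) :
    u c ∈ Set.Icc (0 : ℝ) 1 :=
  ⟨h.zero ▸ h.mono (Nat.zero_le c), h.last ▸ h.mono hc⟩

theorem IsBreakpoints.lt (h : IsBreakpoints q n u) {c c' : ℕ} (hcc : c < c') (hc' : c' ≤ n) :
    u c < u c' :=
  (h.lt_succ c (by omega)).trans_le (h.mono hcc)

theorem IsBreakpoints.mul_chord (h : IsBreakpoints q n u) (F : ℝ → ℝ) {c : ℕ} (hc : c < n) :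
    (u (c + 1) - u c) * chord F u c = F (u (c + 1)) - F (u c) :=
  mul_div_cancel₀ _ (sub_pos.2 (h.lt_succ c hc)).ne'

/-- The sum is the polygon through the graph of `F` at the breakpoints: full cells telescope, cell
`k` contributes its affine part, later cells nothing. -/
theorem IsBreakpoints.sum_chord_mul_overlap (h : IsBreakpoints q n u) {F : ℝ → ℝ} (hF : F 0 = 0)
    {k : ℕ} (hk : k < n) {x : ℝ} (hx : x ∈ Set.Icc (u k) (u (k + 1))) :
    ∑ c ∈ Finset.range n, chord F u c * overlap u x c = F (u k) + chord F u k * (x - u k) := by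
  obtain ⟨d, rfl⟩ : ∃ d, n = k + 1 + d := ⟨n - (k + 1), by omega⟩
  rw [Finset.sum_range_add, Finset.sum_range_succ, overlap_of_mem hx.1 hx.2]
  have h1 : ∑ c ∈ Finset.range k, chord F u c * overlap u x c = F (u k) := by
    rw [← sub_zero (F (u k)), ← hF, ← h.zero, ← Finset.sum_range_sub (fun c => F (u c))]
    refine Finset.sum_congr rfl fun c hc => ?_
    rw [Finset.mem_range] at hc
    rw [overlap_of_ge h.mono ((h.mono hc).trans hx.1), mul_comm, h.mul_chord F (by omega)]
  have h2 : ∑ c ∈ Finset.range d, chord F u (k + 1 + c) * overlap u x (k + 1 + c) = 0 :=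
    Finset.sum_eq_zero fun c _ => by
      rw [overlap_of_le h.mono (hx.2.trans (h.mono (by omega))), mul_zero]
  rw [h1, h2, add_zero]

theorem chord_lorenz_eq (hq : ∀ i, 0 < q i) (hs : ∑ i, q i = 1) (hσ : StrictMono σ)
    (h : IsBreakpoints q n u) {c l : ℕ} (hc : c < n) (hl : 1 ≤ l) (hlm : l ≤ m)
    (h1 : cum q l ≤ u c) (h2 : u (c + 1) ≤ cum q (l + 1)) :
    chord (lorenz q σ) u c = labelled σ l := by
  have hlt := h.lt_succ c hc
  rw [chord, lorenz_sub_eq hq hs hσ (h.mem hc.le).1 hlt.le (h.mem hc).2 hl hlm h1 h2,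
    mul_div_cancel_right₀ _ (sub_pos.2 hlt).ne']

theorem chord_lorenz_le (hq : ∀ i, 0 < q i) (hs : ∑ i, q i = 1) (hσ : StrictMono σ)
    (h : IsBreakpoints q n u) {c l : ℕ} (hc : c < n) (hlm : l ≤ m)
    (h2 : u (c + 1) ≤ cum q (l + 1)) :
    chord (lorenz q σ) u c ≤ labelled σ l ∧
      (chord (lorenz q σ) u c = labelled σ l → cum q l ≤ u c) := by
  have hlt := h.lt_succ c hc
  have hpos := sub_pos.2 hlt
  have key := lorenz_sub_le hq hs hσ (h.mem hc.le).1 hlt (h.mem hc).2 hlm h2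
  exact ⟨(div_le_iff₀ hpos).2 key.1, fun he => key.2 ((div_eq_iff hpos.ne').1 he)⟩

theorem le_chord_lorenz (hq : ∀ i, 0 < q i) (hs : ∑ i, q i = 1) (hσ : StrictMono σ)
    (h : IsBreakpoints q n u) {c l : ℕ} (hc : c < n) (hl : 1 ≤ l) (hlm : l ≤ m)
    (h1 : cum q l ≤ u c) :
    labelled σ l ≤ chord (lorenz q σ) u c ∧
      (chord (lorenz q σ) u c = labelled σ l → u (c + 1) ≤ cum q (l + 1)) := by
  have hlt := h.lt_succ c hc
  have hpos := sub_pos.2 hlt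
  have key := le_lorenz_sub hq hs hσ (h.mem hc.le).1 hlt (h.mem hc).2 hl hlm h1
  exact ⟨(le_div_iff₀ hpos).2 key.1, fun he => key.2 ((div_eq_iff hpos.ne').1 he)⟩

/-- With `l` a piece containing the common end point, the two slopes are separated by `σ l`.
Equality would put three successive breakpoints into that piece. -/
theorem chord_lorenz_lt_succ (hq : ∀ i, 0 < q i) (hs : ∑ i, q i = 1) (hσ : StrictMono σ)
    (hm : 1 ≤ m) (h : IsBreakpoints q n u) {c : ℕ} (hc : c + 1 < n) :
    chord (lorenz q σ) u c < chord (lorenz q σ) u (c + 1) := by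
  obtain ⟨l, hl, hlm, h1, h2⟩ := exists_cum_le hs hm (h.mem (by omega : c + 1 ≤ n))
  have ha := chord_lorenz_le hq hs hσ h (by omega : c < n) hlm h2
  have hb := le_chord_lorenz hq hs hσ h hc hl hlm h1
  refine lt_of_le_of_ne (ha.1.trans hb.1) fun heq => ?_
  have h3 := ha.2 (le_antisymm ha.1 (heq ▸ hb.1))
  have h4 := hb.2 (le_antisymm (heq ▸ ha.1) hb.1)
  have hlt := h.lt_succ c (by omega)
  have hlt' := h.lt_succ (c + 1) hc
  have h5 := h.piece l hl hlm c (by omega) (c + 2) (by omega) h3 (hlt.trans hlt') h4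
  have h6 := h.piece l hl hlm c (by omega) (c + 1) (by omega) h3 hlt h2
  have h7 : u (c + 1 + 1) = u (c + 1) := h5.2.trans h6.2.symm
  exact hlt'.ne' h7

/-- A cell of slope `σ i` either lies in piece `i`, and is then all of it, or extends beyond that
piece on both sides. -/
theorem weight_le_of_chord_lorenz_eq (hq : ∀ i, 0 < q i) (hs : ∑ i, q i = 1) (hσ : StrictMono σ)
    (h : IsBreakpoints q n u) {c : ℕ} (hc : c < n) {i : Fin m}
    (he : chord (lorenz q σ) u c = σ i) : q i ≤ u (c + 1) - u c := by
  rw [← labelled_succ σ i] at he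
  have hcum : cum q (i + 1 + 1) = cum q (i + 1) + q i := by rw [cum_succ (i + 1), labelled_succ]
  have hlt := h.lt_succ c hc
  rcases le_or_gt (cum q (i + 1)) (u c) with h1 | h1
  · have h2 := (le_chord_lorenz hq hs hσ h hc (by omega) (by omega) h1).2 he
    have h3 := h.piece (i + 1) (by omega) (by omega) c hc.le (c + 1) hc h1 hlt h2
    linarith [h3.1, h3.2]
  · rcases le_or_gt (u (c + 1)) (cum q (i + 1 + 1)) with h2 | h2
    · exact absurd ((chord_lorenz_le hq hs hσ h hc (by omega) h2).2 he) (not_le.2 h1)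
    · linarith

theorem chord_lorenz_mem (hq : ∀ i, 0 < q i) (hs : ∑ i, q i = 1) (hσ : StrictMono σ)
    (hσ' : ∀ i, σ i ∈ Set.Icc (0 : ℝ) (1 / 2)) (hm : 1 ≤ m) (h : IsBreakpoints q n u) {c : ℕ}
    (hc : c < n) : chord (lorenz q σ) u c ∈ Set.Icc (0 : ℝ) (1 / 2) := by
  have hlab : ∀ l, 1 ≤ l → l ≤ m → labelled σ l ∈ Set.Icc (0 : ℝ) (1 / 2) := by
    intro l h1 h2
    obtain ⟨i, rfl⟩ := exists_eq_succ h1 h2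
    rw [labelled_succ]
    exact hσ' i
  constructor
  · exact (hlab 1 le_rfl hm).1.trans
      (le_chord_lorenz hq hs hσ h hc le_rfl hm (cum_one.trans_le (h.mem hc.le).1)).1
  · refine (chord_lorenz_le hq hs hσ h hc le_rfl ?_).1.trans (hlab m hm le_rfl).2
    rw [cum_add_one, hs]
    exact (h.mem hc).2

theorem sum_fin_lt {f : ℕ → ℝ} {k : ℕ} (hk : k ≤ n) :
    ∑ j : Fin n with j.1 < k, f j = ∑ j ∈ Finset.range k, f j := by
  rw [Finset.sum_filter, Fin.sum_univ_eq_sum_range (fun j => if j < k then f j else 0),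
    ← Finset.sum_filter]
  congr 1
  ext j
  simp only [Finset.mem_filter, Finset.mem_range]
  omega

theorem sum_lorenz_sub (hq : ∀ i, 0 < q i) (hs : ∑ i, q i = 1) (h : IsBreakpoints q n u) :
    ∑ c : Fin n, (u (c + 1) - u c) * chord (lorenz q σ) u c = ∑ i, q i * σ i := by
  have h1 : ∀ c : Fin n, (u (c + 1) - u c) * chord (lorenz q σ) u c =
      lorenz q σ (u (c + 1)) - lorenz q σ (u c) := fun c => h.mul_chord _ c.2
  simp only [h1]
  rw [Fin.sum_univ_eq_sum_range (fun c => lorenz q σ (u (c + 1)) - lorenz q σ (u c)),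
    Finset.sum_range_sub (fun c => lorenz q σ (u c)), h.zero, h.last, lorenz_zero hq, sub_zero,
    lorenz, sum_range_add_two]
  · refine Finset.sum_congr rfl fun i _ => ?_
    have h2 : cum q (i + 1 + 1) ≤ 1 := by
      rw [← hs, ← cum_add_one]
      exact cum_mono hq (by omega)
    rw [overlap_of_ge (cum_mono hq) h2, cum_succ (i + 1), labelled_succ, labelled_succ]
    ring
  · rw [labelled_zero, zero_mul]
  · rw [labelled_of_lt σ (Nat.lt_succ_self m), zero_mul]

theorem isCoupling_chord (hq : ∀ i, 0 < q i) (hs : ∑ i, q i = 1) (h : IsBreakpoints q n u) :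
    IsCoupling (fun c : Fin n => u (c + 1) - u c) (fun c : Fin n => chord (lorenz q σ) u c) q σ
      fun c i => overlap (cum q) (u (c + 1)) (i + 1) - overlap (cum q) (u c) (i + 1) where
  nonneg c i := sub_nonneg.2 (overlap_mono (cum_mono hq) (h.mono (Nat.le_succ _)) _)
  sum_right c := by
    have hz : ∀ x, overlap (cum q) x 0 = 0 := fun x => overlap_cum_eq_zero x (Or.inl rfl)
    have hz' : ∀ x, overlap (cum q) x (m + 1) = 0 := fun x =>
      overlap_cum_eq_zero x (Or.inr (Nat.lt_succ_self m))
    have h1 := sum_overlap_cum hs (h.mem (by omega : (c : ℕ) + 1 ≤ n))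
    have h2 := sum_overlap_cum hs (h.mem (by omega : (c : ℕ) ≤ n))
    rw [sum_range_add_two (hz _) (hz' _)] at h1 h2
    rw [Finset.sum_sub_distrib, h1, h2]
  sum_left i := by
    have h2 : cum q (i + 1 + 1) ≤ 1 := by
      rw [← hs, ← cum_add_one]
      exact cum_mono hq (by omega)
    have h3 : 0 ≤ cum q (i + 1) := cum_one (q := q) ▸ cum_mono hq (by omega)
    rw [Fin.sum_univ_eq_sum_range (fun c => overlap (cum q) (u (c + 1)) (i + 1) -
      overlap (cum q) (u c) (i + 1)), Finset.sum_range_sub (fun c => overlap (cum q) (u c) (i + 1)),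
      h.zero, h.last, overlap_of_ge (cum_mono hq) h2, overlap_of_le (cum_mono hq) h3,
      cum_succ (i + 1), labelled_succ]
    ring
  sum_mul_le c := by
    rw [h.mul_chord _ c.2, lorenz_sub, sum_range_add_two]
    · refine le_of_eq (Finset.sum_congr rfl fun i _ => ?_)
      rw [labelled_succ, mul_comm]
    · rw [labelled_zero, zero_mul]
    · rw [labelled_of_lt σ (Nat.lt_succ_self m), zero_mul]

/-- The cumulative weights `p 0 + ⋯ + p (k - 1)`. -/
def partialSum {n : ℕ} (p : Fin n → ℝ) (k : ℕ) : ℝ := ∑ j : Fin n with j.1 < k, p j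

theorem partialSum_zero {p : Fin n → ℝ} : partialSum p 0 = 0 := by simp [partialSum]

theorem partialSum_self {p : Fin n → ℝ} : partialSum p n = ∑ j, p j := by simp [partialSum]

theorem partialSum_mono {p : Fin n → ℝ} (hp : ∀ j, 0 ≤ p j) : Monotone (partialSum p) :=
  fun _ _ hab => Finset.sum_le_sum_of_subset_of_nonneg
    (Finset.monotone_filter_right _ fun _ _ h => lt_of_lt_of_le h hab) fun j _ _ => hp j

theorem partialSum_succ {p : Fin n → ℝ} (j : Fin n) :
    partialSum p (j + 1) - partialSum p j = p j := by
  rw [sub_eq_iff_eq_add, partialSum, partialSum, Finset.sum_filter, Finset.sum_filter,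
    ← Finset.sum_erase_add _ _ (Finset.mem_univ j), ← Finset.sum_erase_add _ _ (Finset.mem_univ j)]
  simp only [if_true, lt_irrefl, if_false, add_zero, Order.lt_add_one_iff, le_refl]
  rw [add_comm]
  congr 1
  refine Finset.sum_congr rfl fun i hi => ?_
  have : i.1 ≠ j.1 := fun h => Finset.ne_of_mem_erase hi (Fin.ext h)
  exact if_congr ⟨fun h => by omega, fun h => by omega⟩ rfl rfl

/-- Through `t`, the first `k` cells receive a portion of total weight `partialSum p k`, whose error
mass is at least the value of the curve there. -/
theorem lorenz_partialSum_le (hq : ∀ i, 0 < q i) (hs : ∑ i, q i = 1) (hσ : StrictMono σ)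
    {p e : Fin n → ℝ} (hp : ∀ j, 0 ≤ p j) (hps : ∑ j, p j = 1) {t : Fin n → Fin m → ℝ}
    (ht : IsCoupling p e q σ t) {k : ℕ} (hk : k ≤ n) :
    lorenz q σ (partialSum p k) ≤ ∑ j : Fin n with j.1 < k, p j * e j := by
  have hmem : partialSum p k ∈ Set.Icc (0 : ℝ) 1 :=
    ⟨partialSum_zero (p := p) ▸ partialSum_mono hp (Nat.zero_le k),
      hps ▸ partialSum_self (p := p) ▸ partialSum_mono hp hk⟩
  refine (lorenz_le_sum hq hs hσ hmem (τ := fun i => ∑ j : Fin n with j.1 < k, t j i)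
    (fun i => ⟨Finset.sum_nonneg fun j _ => ht.nonneg j i, ?_⟩) ?_).trans ?_
  · rw [← ht.sum_left i]
    exact Finset.sum_le_sum_of_subset_of_nonneg (Finset.subset_univ _) fun j _ _ => ht.nonneg j i
  · rw [Finset.sum_comm]
    exact Finset.sum_congr rfl fun j _ => ht.sum_right j
  · simp only [Finset.mul_sum]
    rw [Finset.sum_comm]
    refine Finset.sum_le_sum fun j _ => le_of_eq_of_le ?_ (ht.sum_mul_le j)
    exact Finset.sum_congr rfl fun i _ => mul_comm _ _

theorem exists_isCoupling_chord {n' : ℕ} (hq : ∀ i, 0 < q i) (hs : ∑ i, q i = 1)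
    (hσ : StrictMono σ) (h : IsBreakpoints q n' u) {p e : Fin n → ℝ} (he : Monotone e)
    (hp : ∀ j, 0 ≤ p j) (hps : ∑ j, p j = 1) {t : Fin n → Fin m → ℝ} (ht : IsCoupling p e q σ t)
    (hv : ∀ k ≤ n, (∃ c ≤ n', u c = partialSum p k) ∨ ∃ l, 1 ≤ l ∧ l ≤ m ∧ (∃ c ≤ n', u c = cum q l) ∧
      (∃ c ≤ n', u c = cum q (l + 1)) ∧ partialSum p k ∈ Set.Icc (cum q l) (cum q (l + 1))) :
    ∃ M, IsCoupling p e (fun c : Fin n' => u (c + 1) - u c)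
      (fun c : Fin n' => chord (lorenz q σ) u c) M := by
  have hF := lorenz_zero (σ := σ) hq
  have hn' : 0 < n' := Nat.pos_of_ne_zero fun h0 => by
    have := h.last
    rw [h0, h.zero] at this
    exact zero_ne_one this
  -- The polygon agrees with the curve at each cumulative weight: trivially at a breakpoint, and
  -- otherwise because the two ends of the piece are consecutive breakpoints between which the curve
  -- is affine.
  have hH : ∀ k ≤ n, ∑ c ∈ Finset.range n', chord (lorenz q σ) u c * overlap u (partialSum p k) c =
      lorenz q σ (partialSum p k) := by
    intro k hk
    rcases hv k hk with ⟨c, hc, hcv⟩ | ⟨l, hl, hlm, ⟨c, hc, hcl⟩, ⟨c', hc', hcl'⟩, hmem⟩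
    · rw [← hcv]
      rcases Nat.eq_zero_or_pos c with rfl | hc0
      · rw [h.sum_chord_mul_overlap hF hn' ⟨le_rfl, (h.lt_succ 0 hn').le⟩, sub_self, mul_zero,
          add_zero]
      · obtain ⟨d, rfl⟩ : ∃ d, c = d + 1 := ⟨c - 1, by omega⟩
        rw [h.sum_chord_mul_overlap hF (by omega : d < n') ⟨(h.lt_succ d (by omega)).le, le_rfl⟩,
          mul_comm, h.mul_chord _ (by omega)]
        ring
    · have hlt : u c < u c' := by
        rw [hcl, hcl']
        exact cum_lt hq hl hlm
      have hcc : c < c' := by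
        by_contra! h0
        exact absurd hlt (not_lt.2 (h.mono h0))
      have hle : u (c + 1) ≤ cum q (l + 1) := hcl' ▸ h.mono hcc
      have hsucc := h.piece l hl hlm c hc (c + 1) (by omega) hcl.ge (h.lt_succ c (by omega)) hle
      rw [h.sum_chord_mul_overlap hF (by omega : c < n') (by rwa [hsucc.1, hsucc.2]),
        chord_lorenz_eq hq hs hσ h (by omega) hl hlm hcl.ge hle,
        ← lorenz_sub_eq hq hs hσ (h.mem hc).1 (hcl ▸ hmem.1) _ hl hlm hcl.ge hmem.2]
      · ring
      · refine hmem.2.trans ?_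
        rw [← hcl']
        exact (h.mem hc').2
  have hvm := partialSum_mono hp
  have hv0 : ∀ k, 0 ≤ partialSum p k := fun k =>
    partialSum_zero (p := p) ▸ hvm (Nat.zero_le k)
  have hv1 : ∀ k ≤ n, partialSum p k ≤ 1 := fun k hk =>
    hps ▸ partialSum_self (p := p) ▸ hvm hk
  have hsum : ∀ k ≤ n, ∑ c ∈ Finset.range n', overlap u (partialSum p k) c = partialSum p k := by
    intro k hk
    rw [sum_overlap, h.zero, h.last, min_eq_left (hv1 k hk), min_eq_right (hv0 k), sub_zero]
  -- The monotone plan: both families of cells are laid on `[0, 1]` in order, and `t j c` is the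
  -- length of their intersection.
  refine exists_isCoupling_of_partial_sums
    (t := fun j c => overlap u (partialSum p (j + 1)) c - overlap u (partialSum p j) c)
    (fun j c => sub_nonneg.2 (overlap_mono h.mono (hvm (Nat.le_succ _)) _)) (fun j => ?_)
    (fun c => ?_) he fun l hl => ?_
  · rw [Fin.sum_univ_eq_sum_range (fun c => overlap u (partialSum p (j + 1)) c -
      overlap u (partialSum p j) c), Finset.sum_sub_distrib, hsum _ j.2, hsum _ j.2.le,
      partialSum_succ]
  · rw [Fin.sum_univ_eq_sum_range (fun j => overlap u (partialSum p (j + 1)) c -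
      overlap u (partialSum p j) c), Finset.sum_range_sub (fun j => overlap u (partialSum p j) c),
      partialSum_self, hps, partialSum_zero, ← h.last, ← h.zero,
      overlap_of_ge h.mono (h.mono c.2), overlap_of_le h.mono (h.mono (Nat.zero_le _)), sub_zero]
  · refine le_trans (le_of_eq ?_) (lorenz_partialSum_le hq hs hσ hp hps ht hl)
    have h1 : ∀ j, ∑ c : Fin n', (overlap u (partialSum p (j + 1)) c -
        overlap u (partialSum p j) c) * chord (lorenz q σ) u c =
        ∑ c ∈ Finset.range n', chord (lorenz q σ) u c * overlap u (partialSum p (j + 1)) c -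
        ∑ c ∈ Finset.range n', chord (lorenz q σ) u c * overlap u (partialSum p j) c := by
      intro j
      rw [Fin.sum_univ_eq_sum_range (fun c => (overlap u (partialSum p (j + 1)) c -
        overlap u (partialSum p j) c) * chord (lorenz q σ) u c), ← Finset.sum_sub_distrib]
      exact Finset.sum_congr rfl fun c _ => by ring
    simp only [h1]
    rw [sum_fin_lt (f := fun j => ∑ c ∈ Finset.range n', chord (lorenz q σ) u c *
      overlap u (partialSum p (j + 1)) c - ∑ c ∈ Finset.range n', chord (lorenz q σ) u c *
      overlap u (partialSum p j) c) hl, Finset.sum_range_sub (fun j => ∑ c ∈ Finset.range n',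
      chord (lorenz q σ) u c * overlap u (partialSum p j) c), hH l hl, hH 0 (Nat.zero_le n),
      partialSum_zero, hF, sub_zero]

theorem IsBreakpoints.exists_positions (h : IsBreakpoints q n u) (hs : ∑ i, q i = 1)
    (hn : 0 < n) :
    ∃ pos : ℕ → ℕ, pos 0 = 0 ∧ pos n = m + 1 ∧ (∀ c ≤ n, cum q (pos c) ≤ u c) ∧
      (∀ c ≤ n, u c ≤ cum q (pos c + 1)) ∧ ∀ c c', c < c' → c' ≤ n → pos c < pos c' := by
  classical
  have hex : ∀ c, ∃ k, c ≤ n → u c ≤ cum q (k + 1) := fun c => ⟨m, fun hc => by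
    rw [cum_add_one, hs]
    exact (h.mem hc).2⟩
  -- The least label whose piece reaches `u c`; when positive, the cut lies strictly beyond the left
  -- end of that piece.
  let f : ℕ → ℕ := fun c => Nat.find (hex c)
  have hf : ∀ c ≤ n, u c ≤ cum q (f c + 1) := fun c hc => Nat.find_spec (hex c) hc
  have hfm : ∀ c, f c ≤ m := fun c => Nat.find_min' _ fun hc => by
    rw [cum_add_one, hs]
    exact (h.mem hc).2
  have hf0 : f 0 = 0 := (Nat.find_eq_zero _).2 fun _ => by rw [h.zero, zero_add, cum_one]
  have hflt : ∀ c ≤ n, 0 < f c → cum q (f c) < u c := by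
    intro c hc hpos
    have := Nat.find_min (hex c) (Nat.sub_lt hpos one_pos)
    push Not at this
    have h1 : cum q (f c - 1 + 1) < u c := this.2
    rwa [Nat.sub_add_cancel (show 1 ≤ f c from hpos)] at h1
  have hfpos : ∀ c ≤ n, 0 < c → 0 < f c := by
    intro c hc hc0
    by_contra! h0
    have h1 := hf c hc
    rw [Nat.le_zero.1 h0, zero_add, cum_one, ← h.zero] at h1
    exact absurd (h.lt hc0 hc) (not_lt.2 h1)
  have hflt' : ∀ c c', c < c' → c' ≤ n → f c < f c' := by
    intro c c' hcc hc'
    have hle : f c ≤ f c' := Nat.find_min' _ fun _ => (h.mono hcc.le).trans (hf c' hc')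
    refine lt_of_le_of_ne hle fun heq => ?_
    rcases Nat.eq_zero_or_pos c with rfl | hc0
    · rw [hf0] at heq
      exact (hfpos c' hc' hcc).ne heq
    -- Two cuts with the same label would share a piece, the first one strictly beyond its left end;
    -- this is what `piece` forbids.
    · have h1 := hflt c (by omega) (hfpos c (by omega) hc0)
      have h2 := hf c' hc'
      rw [← heq] at h2
      have := h.piece (f c) (hfpos c (by omega) hc0) (hfm c) c (by omega) c' hc' h1.le
        (h.lt hcc hc') h2
      exact h1.ne' this.1
  -- `f` never exceeds `m`, while the convention asks for `m + 1` at the last cut; the piece of that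
  -- label is the single point `1`.
  refine ⟨fun c => if c = n then m + 1 else f c, ?_, if_pos rfl, ?_, ?_, ?_⟩
  · exact (if_neg hn.ne).trans hf0
  · intro c hc
    dsimp only
    split_ifs with hcn
    · rw [cum_add_one, hs, hcn, h.last]
    · rcases Nat.eq_zero_or_pos (f c) with h0 | h0
      · rw [h0, cum_zero]
        exact (h.mem hc).1
      · exact (hflt c hc h0).le
  · intro c hc
    dsimp only
    split_ifs with hcn
    · rw [cum_last, hs]
      exact (h.mem hc).2
    · exact hf c hc
  · intro c c' hcc hc'
    dsimp only
    rw [if_neg (by omega : c ≠ n)]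
    split_ifs with hcn
    · exact Nat.lt_succ_of_le (hfm c)
    · exact hflt' c c' hcc hc'

theorem isCompounded_segment (hq : ∀ i, 0 < q i) (hs : ∑ i, q i = 1)
    (hσ : ∀ i, σ i ∈ Set.Icc (0 : ℝ) (1 / 2)) {a b : ℕ} (hab : a < b) (hb : b ≤ m + 1) {x y : ℝ}
    (hx : x ∈ Set.Icc (0 : ℝ) 1) (hy : y ∈ Set.Icc (0 : ℝ) 1) (hxy : x < y)
    (hxa : cum q a ≤ x) (hxa' : x ≤ cum q (a + 1)) (hyb : cum q b ≤ y)
    (hyb' : y ≤ cum q (b + 1)) :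
    IsCompounded (y - x) ((lorenz q σ y - lorenz q σ x) / (y - x)) (Finset.Icc a b)
      (segment q a b (cum q (a + 1) - x) (cum q (b + 1) - y)) (labelled σ) := by
  have hsub : Finset.Icc a b ⊆ Finset.range (m + 2) := fun l hl => by
    rw [Finset.mem_Icc] at hl
    rw [Finset.mem_range]
    omega
  have hout : ∀ l, l ∉ Finset.Icc a b →
      segment q a b (cum q (a + 1) - x) (cum q (b + 1) - y) l = 0 := by
    intro l hl
    rw [Finset.mem_Icc] at hl
    rw [segment, if_neg (by omega), if_neg (by omega), if_neg (by omega)]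
  refine ⟨?_, fun l _ => ?_, ?_⟩
  · rw [Finset.sum_subset hsub fun l _ hl => hout l hl]
    simp only [segment_eq_overlap_sub hq hab hxa hxa' hyb hyb']
    rw [Finset.sum_sub_distrib, sum_overlap_cum hs hx, sum_overlap_cum hs hy]
  · unfold labelled
    split_ifs
    · exact hσ _
    · norm_num
  · rw [mul_div_cancel₀ _ (sub_pos.2 hxy).ne', lorenz_sub,
      Finset.sum_subset hsub fun l _ hl => by rw [hout l hl, zero_mul]]
    simp only [segment_eq_overlap_sub hq hab hxa hxa' hyb hyb']
    exact Finset.sum_congr rfl fun l _ => mul_comm _ _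

end

end BIDMC
end

/-! ### Optimality, side conditions and the theorem -/

noncomputable section
namespace BIDMC

theorem exists_isBreakpoints {m n k : ℕ} (hmn : n < m) (hkn : k ≤ n) {q : Fin m → ℝ}
    (hq : ∀ i, 0 < q i) (hs : ∑ i, q i = 1) {p : Fin k → ℝ} (hp : ∀ j, 0 ≤ p j)
    (hps : ∑ j, p j = 1) :
    ∃ u, IsBreakpoints q n u ∧ ∀ l ≤ k, (∃ c ≤ n, u c = partialSum p l) ∨
      ∃ i, 1 ≤ i ∧ i ≤ m ∧ (∃ c ≤ n, u c = cum q i) ∧ (∃ c ≤ n, u c = cum q (i + 1)) ∧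
        partialSum p l ∈ Set.Icc (cum q i) (cum q (i + 1)) := by
  classical
  let V : Finset ℝ := (Finset.range (k + 1)).image (partialSum p)
  have hmem : ∀ l ≤ k, partialSum p l ∈ V := fun l hl =>
    Finset.mem_image_of_mem _ (Finset.mem_range.2 (Nat.lt_succ_of_le hl))
  have h1 : partialSum p k = 1 := partialSum_self.trans hps
  have hV : ∀ x ∈ V, x ∈ Set.Icc (0 : ℝ) 1 := by
    intro x hx
    obtain ⟨l, hl, rfl⟩ := Finset.mem_image.1 hx
    exact ⟨partialSum_zero (p := p) ▸ partialSum_mono hp (Nat.zero_le l),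
      h1 ▸ partialSum_mono hp (Nat.lt_succ_iff.1 (Finset.mem_range.1 hl))⟩
  obtain ⟨B, hBc, hB0, hB1, hB, hBV, hBp⟩ := exists_breakpoints hmn cum_one (cum_add_one.trans hs)
    (cum_mono hq) (fun l => cum_lt hq) (V := V)
    (Finset.card_image_le.trans (by rw [Finset.card_range]; omega))
    (partialSum_zero (p := p) ▸ hmem 0 (Nat.zero_le k)) (h1 ▸ hmem k le_rfl) hV
  obtain ⟨u, hu0, hun, hum, hult, huB, hBu⟩ := exists_enumeration hBc hB0 hB1 hB
  refine ⟨u, ⟨hu0, hun, hum, hult, fun l hl hlm c hc c' hc' => hBp l hl hlm _ (huB c hc) _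
    (huB c' hc')⟩, fun l hl => ?_⟩
  rcases hBV _ (hmem l hl) with h | ⟨i, hi, him, h2, h3, h4⟩
  · exact Or.inl (hBu _ h)
  · exact Or.inr ⟨i, hi, him, hBu _ h2, hBu _ h3, h4⟩

theorem isPDegradation_of_errorProb_eq {m n : ℕ} {W Q : BIDMC} (hQ : Q ∈ SymSet m)
    (hW : W ∈ SymSet n) (hWQ : W.IsDegradation Q) (h : W.errorProb = Q.errorProb) :
    IsPDegradation m n W Q := by
  refine ⟨hQ, hW, hWQ, ⟨W, ⟨hW, hWQ⟩, rfl⟩, ?_⟩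
  rintro _ ⟨W', ⟨-, hW'⟩, rfl⟩
  exact h.trans_le hW'.errorProb_le

/-- Once some degradation in `SymSet n` attains the error probability of `Q`, every optimal one
does. -/
theorem IsPDegradation.errorProb_eq {m n : ℕ} {W D Q : BIDMC} (h : IsPDegradation m n W Q)
    (hD : D ∈ SymSet n) (hDQ : D.IsDegradation Q) (hDe : D.errorProb = Q.errorProb) :
    W.errorProb = Q.errorProb :=
  le_antisymm (hDe ▸ h.2.2.2.2 ⟨D, ⟨hD, hDQ⟩, rfl⟩) h.2.2.1.errorProb_le

section

variable {m n : ℕ} {q σ : Fin m → ℝ} {u : ℕ → ℝ}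

/-- The weights of the cells cut out by breakpoints. -/
def IsBreakpoints.weights (h : IsBreakpoints q n u) : stdSimplex ℝ (Fin n) :=
  ⟨fun c => u (c + 1) - u c, fun c => sub_nonneg.2 (h.mono (Nat.le_succ c)), by
    rw [Fin.sum_univ_eq_sum_range (fun c => u (c + 1) - u c), Finset.sum_range_sub, h.zero, h.last,
      sub_zero]⟩

/-- The splitting patterns that describe the breakpoints. -/
def IsBreakpoints.patterns (h : IsBreakpoints q n u) (hs : ∑ i, q i = 1) {pos : ℕ → ℕ}
    (h0 : pos 0 = 0) (hn : pos n = m + 1) (hle : ∀ c ≤ n, cum q (pos c) ≤ u c)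
    (hge : ∀ c ≤ n, u c ≤ cum q (pos c + 1)) (hlt : ∀ c c', c < c' → c' ≤ n → pos c < pos c') :
    SplittingPatterns q n where
  pos j := pos j
  -- The part of piece `pos j` beyond the cut.
  split j := cum q (pos j + 1) - u j
  pos_zero := h0
  pos_last := hn
  pos_strictMono i j hij := hlt i j hij (Nat.lt_succ_iff.1 j.2)
  split_zero := by simp [h0, h.zero, cum_one]
  split_last := by simp [hn, h.last, cum_last, hs]
  split_mem j := by
    have h1 := hle j (Nat.lt_succ_iff.1 j.2)
    have h2 := hge j (Nat.lt_succ_iff.1 j.2)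
    have h3 := cum_succ (q := q) (pos j)
    exact ⟨by linarith, by linarith⟩

/-- A cell that starts at the left end of a piece and stays in it is the whole piece. The label `m +
1` drops out because no cell starts at `1`. -/
theorem IsBreakpoints.eq_of_left_end (h : IsBreakpoints q n u) (hq : ∀ i, 0 < q i)
    (hs : ∑ i, q i = 1) (hσ : StrictMono σ) {c b : ℕ} (hc : c < n) (hb : 1 ≤ b) (hbm : b ≤ m + 1)
    (h1 : u c = cum q b) (h2 : u (c + 1) ≤ cum q (b + 1)) :
    u (c + 1) = cum q (b + 1) ∧ u (c + 1) - u c = labelled q b ∧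
      chord (lorenz q σ) u c = labelled σ b := by
  have hlt := h.lt_succ c hc
  have hbm' : b ≤ m := by
    by_contra! h0
    obtain rfl : b = m + 1 := by omega
    rw [h1, cum_add_one, hs] at hlt
    exact absurd (h.mem hc).2 (not_le.2 hlt)
  have h3 := (h.piece b hb hbm' c hc.le (c + 1) hc h1.ge hlt h2).2
  exact ⟨h3, by rw [h3, h1, cum_succ, add_sub_cancel_left],
    chord_lorenz_eq hq hs hσ h hc hb hbm' h1.ge h2⟩

theorem IsBreakpoints.eq_of_right_end (h : IsBreakpoints q n u) (hq : ∀ i, 0 < q i)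
    (hs : ∑ i, q i = 1) (hσ : StrictMono σ) {c a : ℕ} (hc : c < n) (ham : a ≤ m)
    (h1 : u (c + 1) = cum q (a + 1)) (h2 : cum q a ≤ u c) :
    u c = cum q a ∧ u (c + 1) - u c = labelled q a ∧
      chord (lorenz q σ) u c = labelled σ a := by
  have hlt := h.lt_succ c hc
  have ha : 1 ≤ a := by
    by_contra! h0
    obtain rfl : a = 0 := by omega
    rw [h1, zero_add, cum_one] at hlt
    exact absurd (h.mem hc.le).1 (not_le.2 hlt)
  have h3 := (h.piece a ha ham c hc.le (c + 1) hc h2 hlt h1.le).1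
  exact ⟨h3, by rw [h3, h1, cum_succ, add_sub_cancel_left],
    chord_lorenz_eq hq hs hσ h hc ha ham h2 h1.le⟩

/-- Otherwise the first cell would be a proper part of the first piece. -/
theorem IsBreakpoints.le_first (h : IsBreakpoints q n u) (hm : 0 < m) (hn : 0 < n) :
    q ⟨0, hm⟩ ≤ u 1 - u 0 := by
  have h1 : cum q (1 + 1) = q ⟨0, hm⟩ := by
    have := labelled_succ q ⟨0, hm⟩
    rw [cum_succ, cum_one, zero_add]
    exact this
  rw [h.zero, sub_zero, ← h1]
  by_contra! hlt
  exact hlt.ne (h.piece 1 le_rfl hm 0 (Nat.zero_le n) 1 hn (by rw [cum_one, h.zero])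
    (h.lt_succ 0 hn) hlt.le).2

theorem IsBreakpoints.le_last (h : IsBreakpoints q n u) (hs : ∑ i, q i = 1) (hm : 0 < m)
    (hn : 0 < n) : q ⟨m - 1, by omega⟩ ≤ u n - u (n - 1) := by
  have h2 : cum q (m + 1) = 1 := cum_add_one.trans hs
  have h1 : cum q m = 1 - q ⟨m - 1, by omega⟩ := by
    have h3 := labelled_succ q ⟨m - 1, by omega⟩
    simp only [Nat.sub_add_cancel hm] at h3
    rw [cum_succ, h3] at h2
    linarith
  have h4 : u (n - 1) < u n := h.lt (by omega) le_rfl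
  have h5 : u (n - 1) ≤ cum q m := by
    by_contra! hlt
    exact hlt.ne' (h.piece m hm le_rfl (n - 1) (by omega) n le_rfl hlt.le h4
      (by rw [h2, h.last])).1
  rw [h.last]
  linarith

end

end BIDMC
end

theorem theorem3 (m n : ℕ) (hn : 2 ≤ n) (hmn : n < m)
    (q : stdSimplex ℝ (Fin m)) (σ : Fin m → unitInterval)
    (hσ : StrictMono σ) (hσ_half : ∀ i, (σ i : ℝ) ≤ 1 / 2)
    (Q : BIDMC) (hQ : Q.Equivalent (BIDMC.bscMix q σ)) (hQ_star : Q ∈ BIDMC.SymSetStar m)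
    (W : BIDMC) (hW : W ∈ BIDMC.SymSet n) (hWQ : W.IsDegradation Q) :
    ∃ (T : BIDMC.SplittingPatterns q n) (p : stdSimplex ℝ (Fin n)) (ε : Fin n → unitInterval),
      BIDMC.IsSegmentCompound q σ T p ε ∧
      W.IsDegradation (BIDMC.bscMix p ε) ∧
      (BIDMC.IsPDegradation m n W Q → BIDMC.IsPDegradation n n W (BIDMC.bscMix p ε)) ∧
      BIDMC.IsPDegradation m n (BIDMC.bscMix p ε) Q ∧
      StrictMono ε ∧ (∀ j, (ε j : ℝ) ≤ 1 / 2) ∧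
      (∀ j : Fin n, T.pos j.succ = T.pos j.castSucc + 1 →
        (T.split j.castSucc = 0 →
          T.split j.succ = 0 ∧
          p j = BIDMC.labelled q (T.pos j.succ) ∧
          (ε j : ℝ) = BIDMC.labelled (fun i => (σ i : ℝ)) (T.pos j.succ)) ∧
        (T.split j.succ = BIDMC.labelled q (T.pos j.succ) →
          T.split j.castSucc = BIDMC.labelled q (T.pos j.castSucc) ∧
          p j = BIDMC.labelled q (T.pos j.castSucc) ∧
          (ε j : ℝ) = BIDMC.labelled (fun i => (σ i : ℝ)) (T.pos j.castSucc))) ∧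
      (∀ (j : Fin n) (i : Fin m), ε j = σ i → q i ≤ p j) ∧
      q ⟨0, by omega⟩ ≤ p ⟨0, by omega⟩ ∧
      q ⟨m - 1, by omega⟩ ≤ p ⟨n - 1, by omega⟩ := by
  obtain ⟨p', ε', hWeq, hε'mono, hε'half⟩ := BIDMC.exists_monotone_bscMix hW
  have hq : ∀ i, 0 < q i := BIDMC.pos_of_mem_symSetStar hQ hQ_star
  have hs : ∑ i, q i = 1 := BIDMC.sum_weight q
  have hσm : StrictMono fun i => (σ i : ℝ) := fun i j hij => hσ hij
  have hσ01 : ∀ i, (σ i : ℝ) ∈ Set.Icc (0 : ℝ) (1 / 2) := fun i => ⟨(σ i).2.1, hσ_half i⟩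
  obtain ⟨t, ht⟩ := BIDMC.exists_isCoupling_of_isDegradation hσ_half
    ((hWeq.symm.isDegradation.trans hWQ).trans hQ.isDegradation)
  obtain ⟨u, hu, hv⟩ := BIDMC.exists_isBreakpoints hmn le_rfl hq hs
    (BIDMC.weight_nonneg p') (BIDMC.sum_weight p')
  obtain ⟨M, hM⟩ := BIDMC.exists_isCoupling_chord hq hs hσm hu (fun i j hij => hε'mono hij)
    (BIDMC.weight_nonneg p') (BIDMC.sum_weight p') ht hv
  obtain ⟨pos, hpos0, hposn, hposle, hposge, hposlt⟩ :=
    hu.exists_positions hs (by omega : 0 < n)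
  have hle : ∀ j : Fin n, pos (j + 1) ≤ m + 1 := fun j => by
    rcases (Nat.succ_le_of_lt j.2).eq_or_lt with h | h
    · exact (hposn ▸ congrArg pos h).le
    · exact (hposn ▸ hposlt (j + 1) n h le_rfl).le
  let F := BIDMC.lorenz q fun i => (σ i : ℝ)
  have hmem : ∀ c : Fin n, BIDMC.chord F u c ∈ Set.Icc (0 : ℝ) (1 / 2) := fun c =>
    BIDMC.chord_lorenz_mem hq hs hσm hσ01 (by omega) hu c.2
  let ε : Fin n → unitInterval := fun c =>
    ⟨BIDMC.chord F u c, (hmem c).1, (hmem c).2.trans (by norm_num)⟩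
  have hεhalf : ∀ c, (ε c : ℝ) ≤ 1 / 2 := fun c => (hmem c).2
  have hεmono : StrictMono ε := by
    obtain ⟨n, rfl⟩ : ∃ k, n = k + 1 := ⟨n - 1, by omega⟩
    refine Fin.strictMono_iff_lt_succ.2 fun c => ?_
    exact BIDMC.chord_lorenz_lt_succ hq hs hσm (by omega) hu (Nat.succ_lt_succ c.2)
  have hpos : ∀ c, 0 < hu.weights c := fun c => sub_pos.2 (hu.lt_succ c c.2)
  have hQm : Q ∈ BIDMC.SymSet m := hQ_star.1
  have hDn := BIDMC.bscMix_mem_symSet hu.weights ε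
  have hWD : W.IsDegradation (BIDMC.bscMix hu.weights ε) :=
    hWeq.isDegradation.trans (BIDMC.IsCoupling.isDegradation hε'half hM)
  have hDQ : (BIDMC.bscMix hu.weights ε).IsDegradation Q :=
    (BIDMC.IsCoupling.isDegradation (p := hu.weights) (ε := ε) hεhalf
      (BIDMC.isCoupling_chord hq hs hu)).trans hQ.symm.isDegradation
  have hDe : (BIDMC.bscMix hu.weights ε).errorProb = Q.errorProb := by
    rw [hQ.errorProb_eq, BIDMC.bscMix_errorProb _ hεhalf, BIDMC.bscMix_errorProb _ hσ_half]
    exact congrArg ENNReal.ofReal (BIDMC.sum_lorenz_sub hq hs hu)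
  refine ⟨hu.patterns hs hpos0 hposn hposle hposge hposlt, hu.weights, ε,
    ⟨BIDMC.bscMix_mem_symSetStar (by omega) hpos hεmono hεhalf, fun j => ?_⟩, hWD, fun hP => ?_,
    BIDMC.isPDegradation_of_errorProb_eq hQm hDn hDQ hDe, hεmono, hεhalf, fun j hj => ⟨?_, ?_⟩,
    fun j i hji => BIDMC.weight_le_of_chord_lorenz_eq hq hs hσm hu j.2 (congrArg Subtype.val hji),
    hu.le_first (by omega) (by omega), ?_⟩
  · refine BIDMC.isCompounded_segment hq hs hσ01 (hposlt j (j + 1) (Nat.lt_succ_self _) j.2) (hle j)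
      (hu.mem j.2.le) (hu.mem j.2) (hu.lt_succ j j.2) (hposle j j.2.le) (hposge j j.2.le)
      (hposle (j + 1) j.2) (hposge (j + 1) j.2)
  · exact BIDMC.isPDegradation_of_errorProb_eq hDn hW hWD
      ((hP.errorProb_eq hDn hDQ hDe).trans hDe.symm)
  · intro h0
    change pos (j + 1) = pos j + 1 at hj
    -- Nothing of piece `pos j` remains, so the cell starts at the left end of the adjacent piece
    -- `pos (j + 1)`.
    change BIDMC.cum q (pos j + 1) - u j = 0 at h0
    obtain ⟨h1, h2, h3⟩ := hu.eq_of_left_end hq hs hσm j.2 (by omega) (hle j)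
      (by rw [hj]; linarith) (hposge (j + 1) j.2)
    exact ⟨sub_eq_zero.2 h1.symm, h2, h3⟩
  · intro h0
    change pos (j + 1) = pos j + 1 at hj
    -- The whole piece `pos (j + 1)` lies beyond the cut, so the cell ends at the right end of piece
    -- `pos j`.
    change BIDMC.cum q (pos (j + 1) + 1) - u (j + 1) = BIDMC.labelled q (pos (j + 1)) at h0
    obtain ⟨h1, h2, h3⟩ := hu.eq_of_right_end hq hs hσm j.2 (by have := hle j; omega : pos j ≤ m)
      (by rw [BIDMC.cum_succ (pos (j + 1))] at h0; rw [← hj]; linarith)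
      (hposle j j.2.le)
    refine ⟨?_, h2, h3⟩
    change BIDMC.cum q (pos j + 1) - u j = BIDMC.labelled q (pos j)
    rw [h1, BIDMC.cum_succ, add_sub_cancel_left]
  · have h := hu.le_last hs (by omega) (by omega : 0 < n)
    refine h.trans_eq ?_
    change _ = u (n - 1 + 1) - u (n - 1)
    rw [Nat.sub_add_cancel (by omega : 1 ≤ n)]
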